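/- **Setting.** Let $\theta^*\in\mathbb R^M$ be a fixed unknown parameter. Agents $n=1,\dots,N$ make, at times $t=0,1,2,\dots$, the measurements $$y_n(t)=H_n\theta^*+w_n(t)+a_n(t)\in\mathbb R^{P_n},$$ with known matrices $H_n\in\mathbb R^{P_n\times M}$, noises $w_n(t)$ and attacks $a_n(t)$. Label the $P=\sum_n P_n$ scalar measurement streams by $p\in\mathcal P=\{1,\dots,P\}$, let $h_p^\top$ be the corresponding row of the stacked matrix of the $H_n$, and let $w^{(p)}(t)$, $a^{(p)}(t)$ be the corresponding scalar noise and attack. At time $t$ the agents communicate over a random simple undirected graph $G(t)$ on $\{1,\dots,N\}$ with Laplacian $L(t)$ and neighbourhoods $\Omega_n(t)$. Agent $n$ has an interest set $\mathcal I_n\subseteq\{1,\dots,M\}$, and $\mathcal J_m=\{n: m\in\mathcal I_n\}$. Let $\mathcal F_t=\sigma\big(L(s),w_n(s): s<t,\ 1\le n\le N\big)$. **Assumptions.** 1. For each $n$ the $w_n(t)$, $t\ge 0$, are i.i.d. with zero mean and finite covariance $\Sigma_n$; the noises are independent across agents; the noises at time $t$ are independent of $\mathcal F_t$. 2. $\|h_p\|_2=1$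 for every $p$. 3. For each $n$, $\{m: H_ne_m\ne 0\}\subseteq\mathcal I_n$; and $|\mathcal J_m|>0$ for every $m$. 4. $\sum_{p\in\mathcal P}h_ph_p^\top$ is invertible. 5. The Laplacians $L(t)$ are i.i.d., $L(t)$ is independent of $\mathcal F_t$, and $\{L(t)\}$ is independent of $\{w_n(t)\}$. 6. For each $m$, with $L_m(t)$ the Laplacian of the subgraph $G_m(t)$ of $G(t)$ induced by $\mathcal J_m$, the second smallest eigenvalue of $\mathbb E[L_m(t)]$ is positive (no requirement if $|\mathcal J_m|=1$). 7. The attacks $a_n(t)$ are arbitrary, deterministic or random (with no assumption on their law or on their dependence on the other random objects). The set of compromised streams is $\mathcal A=\{p:\exists t,\ a^{(p)}(t)\neq0\}$, formed along each sample path if the attack is random; put $\mathcal N=\mathcal P\setminus\mathcal A$. Almost surely $|\mathcal A|<P$. **Algorithm SAFE.** Let $\alpha_t=a(t+1)^{-\tau_1}$, $\beta_t=b(t+1)^{-\tau_2}$, $\gamma_t=\Gamma(t+1)^{-\tau_\gamma}$ with $a,b,\Gamma>0$, $0<\tau_2<\tau_1<1$ and $0<\tau_\gamma<\min(\tfrac12,\tau_1-\tau_2,1-\tau_1)$.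 Let $\overline y_n(t)=\frac{t}{t+1}\overline y_n(t-1)+\frac1{t+1}y_n(t)$, $\overline y_n(-1)=0$, and let $H_n^c$ be $H_n$ without the columns whose indices are not in $\mathcal I_n$. The estimate $x_n(t)\in\mathbb R^{\mathcal I_n}$ of agent $n$ starts at $x_n(0)=0$ and follows $$x_n(t+1)=x_n(t)-\beta_t\sum_{l\in\Omega_n(t)}\big(x^p_{l,n}(t)-x^c_{l,n}(t)\big)+\alpha_t (H_n^c)^\top K_n(t)\big(\overline y_n(t)-H_n^cx_n(t)\big).$$ Here, for $i\in\mathcal I_n$, $[x^p_{l,n}(t)]_i=[x_n(t)]_i$ and $[x^c_{l,n}(t)]_i=[x_l(t)]_i$ if $i\in\mathcal I_l$, and both are $0$ if $i\notin\mathcal I_l$. The matrix $K_n(t)$ is diagonal; its entry for a component $r$ of $\overline y_n(t)-H_n^cx_n(t)$ is $\min(1,\gamma_t|r|^{-1})$ ($=1$ if $r=0$). **Theorem 1.** Suppose in addition that (almost surely, if the attack is random) the resilience condition $$\lambda_{\min}(\mathcal G_{\mathcal N})>\Delta_{\mathcal A}$$ holds, where $$\mathcal G_{\mathcal N}=\sum_{p\in\mathcal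 N}h_ph_p^\top,\qquad \Delta_{\mathcal A}=\max_{v\in\mathbb R^{|\mathcal A|},\ \|v\|_\infty\le1}\|\mathcal H_{\mathcal A}^\top v\|_2,$$ and $\mathcal H_{\mathcal A}$ stacks the rows $h_p^\top$, $p\in\mathcal A$. Then for every agent $n$ and every $0\le\tau_0<\min(\tau_\gamma,\tfrac12-\tau_\gamma)$, $$\mathbb P\Big(\lim_{t\to\infty}(t+1)^{\tau_0}\,\|x_n(t)-\theta^*_{\mathcal I_n}\|_2=0\Big)=1,$$ where $\theta^*_{\mathcal I_n}\in\mathbb R^{\mathcal I_n}$ is the vector of the components of $\theta^*$ with index in $\mathcal I_n$. -/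

import Mathlib

open Filter Topology MeasureTheory ProbabilityTheory

noncomputable section

namespace SAFE

/-! ### Measurement streams, interest sets and Gramians

Agents are `Fin N`, field components are `Fin M`, agent `n` makes `P n` scalar measurements.
A scalar measurement stream is a pair `⟨n, i⟩` : the `i`-th scalar measurement of agent `n`. -/

/-- The index set of all scalar measurement streams. -/
abbrev Stream {N : ℕ} (P : Fin N → ℕ) : Type := (n : Fin N) × Fin (P n)

/-- The measurement vector `h_p` of stream `p`: a row of the measurement matrix of its agent. -/
def measVec {N M : ℕ} {P : Fin N → ℕ} (H : ∀ n, Matrix (Fin (P n)) (Fin M) ℝ)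
    (p : Stream P) : Fin M → ℝ :=
  H p.1 p.2

/-- The physical coupling set of an agent with measurement matrix `H`: the components `m` with
`H e_m ≠ 0`. -/
def couplingSet {M k : ℕ} (H : Matrix (Fin k) (Fin M) ℝ) : Set (Fin M) :=
  {m | H.mulVec (Pi.single m 1) ≠ 0}

/-- The set `J_m` of all agents interested in component `m`. -/
def interestedAgents {N M : ℕ} (I : Fin N → Finset (Fin M)) (m : Fin M) : Finset (Fin N) :=
  Finset.univ.filter fun n => m ∈ I n

/-- The observability Gramian `∑_{p ∈ X} h_p h_pᵀ` of a set of streams. -/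
def gramian {N M : ℕ} {P : Fin N → ℕ} (H : ∀ n, Matrix (Fin (P n)) (Fin M) ℝ)
    (X : Finset (Stream P)) : Matrix (Fin M) (Fin M) ℝ :=
  ∑ p ∈ X, Matrix.vecMulVec (measVec H p) (measVec H p)

/-- A set of streams is globally observable if its Gramian is invertible. -/
def GloballyObservable {N M : ℕ} {P : Fin N → ℕ} (H : ∀ n, Matrix (Fin (P n)) (Fin M) ℝ)
    (X : Finset (Stream P)) : Prop :=
  IsUnit (gramian H X)

theorem gramian_isHermitian {N M : ℕ} {P : Fin N → ℕ} (H : ∀ n, Matrix (Fin (P n)) (Fin M) ℝ)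
    (X : Finset (Stream P)) : (gramian H X).IsHermitian := by
  ext i j
  simp [gramian, Matrix.sum_apply, Matrix.vecMulVec_apply, mul_comm]

/-- The smallest eigenvalue of a real symmetric matrix (of positive size). -/
def lambdaMin {ι : Type*} [Fintype ι] [DecidableEq ι] {A : Matrix ι ι ℝ}
    (hA : A.IsHermitian) : ℝ :=
  ⨅ i, hA.eigenvalues i

/-- The second smallest eigenvalue, counted with multiplicity, of a real symmetric matrix of size
at least two. (`eigenvalues₀` lists the eigenvalues with multiplicity in decreasing order.) -/
def lambdaTwo {ι : Type*} [Fintype ι] [DecidableEq ι] {A : Matrix ι ι ℝ}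
    (hA : A.IsHermitian) (hcard : 2 ≤ Fintype.card ι) : ℝ :=
  hA.eigenvalues₀ ⟨Fintype.card ι - 2, by omega⟩

/-- The matrix `H_A` that stacks the rows `h_pᵀ` for `p ∈ A`. -/
def stackedRows {N M : ℕ} {P : Fin N → ℕ} (H : ∀ n, Matrix (Fin (P n)) (Fin M) ℝ)
    (A : Finset (Stream P)) : Matrix A (Fin M) ℝ :=
  Matrix.of fun p => measVec H p.1

/-- `Δ_A`, the maximum of `‖H_Aᵀ v‖₂` over all `v ∈ ℝ^A` with `‖v‖_∞ ≤ 1`. (The norm of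
`A → ℝ` is the sup norm; the supremum is over a nonempty compact set.) -/
def attackStrength {N M : ℕ} {P : Fin N → ℕ} (H : ∀ n, Matrix (Fin (P n)) (Fin M) ℝ)
    (A : Finset (Stream P)) : ℝ :=
  sSup ((fun v : A → ℝ => ‖WithLp.toLp 2 ((stackedRows H A).transpose.mulVec v)‖) ''
    {v : A → ℝ | ‖v‖ ≤ 1})

/-- The set of compromised streams of an attack `a`, where `a n t` is the vector that the attacker
adds to the measurement of agent `n` at time `t`. -/
def compromised {N : ℕ} {P : Fin N → ℕ} (a : ∀ n : Fin N, ℕ → Fin (P n) → ℝ) :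
    Finset (Stream P) :=
  open Classical in Finset.univ.filter fun p => ∃ t, a p.1 t p.2 ≠ 0

/-- The resilience condition `λ_min(G_𝒩) > Δ_A`, where `𝒩` is the complement of `A`. -/
def Resilient {N M : ℕ} {P : Fin N → ℕ} (H : ∀ n, Matrix (Fin (P n)) (Fin M) ℝ)
    (A : Finset (Stream P)) : Prop :=
  attackStrength H A < lambdaMin (gramian_isHermitian H Aᶜ)

/-! ### Random graphs -/

/-- The Laplacian matrix of a simple graph. -/
def laplacian {V : Type*} [Fintype V] [DecidableEq V] (G : SimpleGraph V) : Matrix V V ℝ :=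
  open Classical in G.lapMatrix ℝ

/-- The Laplacian matrix as a doubly indexed family of reals, which is the form in which its law and
its independence are stated (real families carry the product σ-algebra). -/
def laplacianEntries {V : Type*} [Fintype V] [DecidableEq V] (G : SimpleGraph V) : V → V → ℝ :=
  fun i j => laplacian G i j

/-- The Laplacian `L_m` of the subgraph of `G` induced by `J`. -/
def inducedLaplacian {N : ℕ} (J : Finset (Fin N)) (G : SimpleGraph (Fin N)) : Matrix J J ℝ :=
  laplacian (G.induce (J : Set (Fin N)))

/-- The mean of the Laplacian of the subgraph induced by `J`, for a random graph `G`. -/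
def meanInducedLaplacian {N : ℕ} {Ω : Type*} [MeasurableSpace Ω] (μ : Measure Ω)
    (J : Finset (Fin N)) (G : Ω → SimpleGraph (Fin N)) : Matrix J J ℝ :=
  Matrix.of fun i j => ∫ ω, inducedLaplacian J (G ω) i j ∂μ

theorem meanInducedLaplacian_isHermitian {N : ℕ} {Ω : Type*} [MeasurableSpace Ω] (μ : Measure Ω)
    (J : Finset (Fin N)) (G : Ω → SimpleGraph (Fin N)) :
    (meanInducedLaplacian μ J G).IsHermitian := by
  classical
  have key : ∀ (K : SimpleGraph (Fin N)) (i j : J),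
      inducedLaplacian J K j i = inducedLaplacian J K i j := fun K i j =>
    (SimpleGraph.isSymm_lapMatrix (R := ℝ) (K.induce (J : Set (Fin N)))).apply i j
  ext i j
  simp [meanInducedLaplacian, Matrix.conjTranspose_apply, key]

/-- The subgraph of the random graph `G` induced by `J` is connected on average: the second
smallest eigenvalue of its mean Laplacian is positive. A subgraph with fewer than two vertices has
no second eigenvalue, and nothing is required of it. -/
def ConnectedOnAverage {N : ℕ} {Ω : Type*} [MeasurableSpace Ω] (μ : Measure Ω)
    (J : Finset (Fin N)) (G : Ω → SimpleGraph (Fin N)) : Prop :=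
  ∀ hcard : 2 ≤ Fintype.card J, 0 < lambdaTwo (meanInducedLaplacian_isHermitian μ J G) hcard

/-- The natural filtration: the σ-algebra generated by the Laplacians and noises at times
`0, …, t - 1`. -/
abbrev history {N : ℕ} {P : Fin N → ℕ} {Ω : Type*} (G : ℕ → Ω → SimpleGraph (Fin N))
    (w : ∀ n : Fin N, ℕ → Ω → Fin (P n) → ℝ) (t : ℕ) : MeasurableSpace Ω :=
  ⨆ s : Fin t, (MeasurableSpace.comap (fun ω => laplacianEntries (G s ω)) inferInstance ⊔
    ⨆ n, MeasurableSpace.comap (w n s) inferInstance)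

/-! ### The algorithm -/

/-- The time average `ȳ(t) = t/(t+1) ȳ(t-1) + 1/(t+1) y(t)`, with `ȳ(-1) = 0`. -/
def timeAverage {k : ℕ} (y : ℕ → Fin k → ℝ) : ℕ → Fin k → ℝ
  | 0 => y 0
  | t + 1 => (((t : ℝ) + 1) / ((t : ℝ) + 2)) • timeAverage y t + (1 / ((t : ℝ) + 2)) • y (t + 1)

/-- The censored measurement matrix: `H` without the columns outside the interest set. -/
def censoredMatrix {M k : ℕ} (H : Matrix (Fin k) (Fin M) ℝ) (I : Finset (Fin M)) :
    Matrix (Fin k) I ℝ :=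
  Matrix.of fun i m => H i m

/-- Extraction of the components in `I` from a vector `x` with components in `I'`, with zeros for
the components of `I` outside `I'`. This is the censored message `x^c` that an agent with interest
set `I` makes of the estimate `x` of a neighbour with interest set `I'`. -/
def censor {M : ℕ} (I I' : Finset (Fin M)) (x : I' → ℝ) : I → ℝ :=
  fun i => if h : (i : Fin M) ∈ I' then x ⟨i, h⟩ else 0

/-- The processed version `x^p` of an agent's own estimate `x`, for a neighbour with interest set
`I'`: the components outside `I'` are set to zero. -/
def processOwn {M : ℕ} (I I' : Finset (Fin M)) (x : I → ℝ) : I → ℝ :=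
  fun i => if (i : Fin M) ∈ I' then x i else 0

/-- The scalar gain `min(1, γ / |r|)` for the innovation `r`, equal to `1` at `r = 0`. -/
def gain (γ r : ℝ) : ℝ := if r = 0 then 1 else min 1 (γ * |r|⁻¹)

/-- The diagonal gain matrix for the innovation vector `r`. -/
def gainMatrix {k : ℕ} (γ : ℝ) (r : Fin k → ℝ) : Matrix (Fin k) (Fin k) ℝ :=
  Matrix.diagonal fun i => gain γ (r i)

/-- The polynomially decaying sequence `c / (t+1)^τ`. -/
def decay (c τ : ℝ) (t : ℕ) : ℝ := c / ((t : ℝ) + 1) ^ τ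

/-- The parameters of the weight sequences `α_t = a/(t+1)^τ₁`, `β_t = b/(t+1)^τ₂` and of the
threshold `γ_t = Γ/(t+1)^τγ`. -/
structure Params where
  a : ℝ
  b : ℝ
  Γ : ℝ
  τ₁ : ℝ
  τ₂ : ℝ
  τγ : ℝ

/-- The admissible choices of the parameters. -/
structure Params.Admissible (S : Params) : Prop where
  a_pos : 0 < S.a
  b_pos : 0 < S.b
  Γ_pos : 0 < S.Γ
  τ₂_pos : 0 < S.τ₂
  τ₂_lt : S.τ₂ < S.τ₁
  τ₁_lt : S.τ₁ < 1
  τγ_pos : 0 < S.τγ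
  τγ_lt : S.τγ < min (1 / 2) (min (S.τ₁ - S.τ₂) (1 - S.τ₁))

/-- The estimates of all agents along one sample path of the graphs `G t` and the (possibly
attacked) measurements `y n t`. The estimate of agent `n` is a vector indexed by its interest set
`I n`. -/
def estimate {N M : ℕ} {P : Fin N → ℕ} (S : Params) (H : ∀ n, Matrix (Fin (P n)) (Fin M) ℝ)
    (I : Fin N → Finset (Fin M)) (G : ℕ → SimpleGraph (Fin N))
    (y : ∀ n : Fin N, ℕ → Fin (P n) → ℝ) : ℕ → (n : Fin N) → I n → ℝ
  | 0 => fun _ => 0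
  | t + 1 => fun n =>
      open Classical in
      let x := estimate S H I G y t
      let Hc := censoredMatrix (H n) (I n)
      let r := timeAverage (y n) t - Hc.mulVec (x n)
      x n
        - decay S.b S.τ₂ t • ∑ l ∈ (G t).neighborFinset n,
            (processOwn (I n) (I l) (x n) - censor (I n) (I l) (x l))
        + decay S.a S.τ₁ t •
            Hc.transpose.mulVec ((gainMatrix (decay S.Γ S.τγ t) r).mulVec r)

/-- The attacked measurement `y_n(t) = H_n θ + w_n(t) + a_n(t)` along a sample path. -/
def measurement {N M : ℕ} {P : Fin N → ℕ} (H : ∀ n, Matrix (Fin (P n)) (Fin M) ℝ)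
    (θ : Fin M → ℝ) (w a : ∀ n : Fin N, ℕ → Fin (P n) → ℝ) (n : Fin N) (t : ℕ) : Fin (P n) → ℝ :=
  (H n).mulVec θ + w n t + a n t

/-- The subvector of `θ` with components in `I`. -/
def restrictTo {M : ℕ} (I : Finset (Fin M)) (θ : Fin M → ℝ) : I → ℝ := fun i => θ i

end SAFE

end

/-! Clipping makes the argument robust. Whatever the attacks do, and whatever they depend on, one
innovation step changes an estimate by at most a constant times $\alpha_t\gamma_t$. The errors split
into the disagreement between the agents interested in a component and the error of their average.
Both are handled on a single sample path; probability enters only through the graphs and the noises.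

Disagreement. The estimates may depend on the attacks, hence on future graphs, so no conditional
expectation of them is available. Instead, random averaging is applied to finitely many
deterministic vectors, the centered basis vectors. Since the mean Laplacian has a spectral gap, the
mean square of their image over a window of length about $(t+1)^\rho$, $\tau_2<\rho<\tau_1$, is at
most a constant times $\exp(-c(t+1)^{\rho-\tau_2})$, which is summable against any power
(`integral_flow_le`, `ae_tendsto_flow`). By linearity the almost sure decay passes to any
disagreement vector, however it arose. What was injected within the window is of order
$(t+1)^{\rho-\tau_1-\tau_\gamma}=o((t+1)^{-\tau_\gamma})$ (`tendsto_disagreement`).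

Average error. Averaging preserves sums, so the averages move only by clipped innovations
(`averageError_succ`). Uncompromised innovations equal $-h_p^\top E$ up to $o(\gamma_t)$, by
consensus and the strong law with rate (`ae_tendsto_noise_average`). If $\|E\|\ge\gamma_t$, clipping
keeps at least the fraction $\gamma_t/\|E\|$ of each, which gives an inward pull of at least
$\gamma_t\lambda_{\min}(\mathcal G_{\mathcal N})\|E\|$; the compromised streams push back by at most
$\gamma_t\Delta_{\mathcal A}\|E\|$ (`sum_measVec_mul_le`). Resilience makes the net drift a negative
multiple of $\alpha_t\gamma_t$. As $\tau_1+\tau_\gamma<1$, these drifts have divergent sum and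
outpace the decrease of $\gamma_t$, so $\|E\|=O(\gamma_t)$ (`exists_le_mul_decay_of_drift`). Every
$\tau_0<\tau_\gamma$ follows. -/

namespace SAFE

/-! ### Averaging with symmetric weights: energy, contraction and products of steps -/

section Diffusion

variable {ι : Type*} [Fintype ι]

/-- The action of the Laplacian with edge weights `c`. -/
noncomputable def diffusion (c : ι → ι → ℝ) (z : ι → ℝ) : ι → ℝ :=
  fun i => ∑ j, c i j * (z i - z j)

/-- The Dirichlet energy of the Laplacian with edge weights `c`. -/
noncomputable def energy (c : ι → ι → ℝ) (z : ι → ℝ) : ℝ :=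
  (1 / 2) * ∑ i, ∑ j, c i j * (z i - z j) ^ 2

theorem norm_toLp_sq (z : ι → ℝ) : ‖WithLp.toLp 2 z‖ ^ 2 = ∑ i, z i ^ 2 := by
  rw [EuclideanSpace.real_norm_sq_eq]

theorem abs_le_norm_toLp (z : ι → ℝ) (i : ι) : |z i| ≤ ‖WithLp.toLp 2 z‖ := by
  have := PiLp.norm_apply_le (WithLp.toLp 2 z) i
  simpa using this

theorem norm_toLp_le_of_abs_le (z : ι → ℝ) {B : ℝ} (hz : ∀ i, |z i| ≤ B) :
    ‖WithLp.toLp 2 z‖ ≤ Fintype.card ι * B := by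
  rcases isEmpty_or_nonempty ι with h | ⟨⟨i₀⟩⟩
  · simp [EuclideanSpace.norm_eq]
  have hB : 0 ≤ B := (abs_nonneg _).trans (hz i₀)
  have hc : (1 : ℝ) ≤ Fintype.card ι := by
    exact_mod_cast Fintype.card_pos_iff.2 ⟨i₀⟩
  refine abs_le_of_sq_le_sq' ?_ (by positivity) |>.2
  rw [norm_toLp_sq]
  calc ∑ i, z i ^ 2 ≤ ∑ _i : ι, B ^ 2 := Finset.sum_le_sum fun i _ => sq_le_sq' (neg_le_of_abs_le (hz i)) (le_of_abs_le (hz i))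
    _ = Fintype.card ι * B ^ 2 := by simp
    _ ≤ (Fintype.card ι * B) ^ 2 := by nlinarith [sq_nonneg B]

theorem sum_diffusion {c : ι → ι → ℝ} (hc : ∀ i j, c i j = c j i) (z : ι → ℝ) :
    ∑ i, diffusion c z i = 0 := by
  have h : ∑ i, diffusion c z i = -∑ i, diffusion c z i := by
    conv_lhs => simp only [diffusion]
    rw [Finset.sum_comm, ← Finset.sum_neg_distrib]
    refine Finset.sum_congr rfl fun i _ => ?_
    rw [diffusion, ← Finset.sum_neg_distrib]
    refine Finset.sum_congr rfl fun j _ => ?_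
    rw [hc j i]; ring
  linarith

theorem sum_mul_diffusion {c : ι → ι → ℝ} (hc : ∀ i j, c i j = c j i) (z : ι → ℝ) :
    ∑ i, z i * diffusion c z i = energy c z := by
  have h1 : ∑ i, z i * diffusion c z i = ∑ i, ∑ j, c i j * (z i * (z i - z j)) := by
    refine Finset.sum_congr rfl fun i _ => ?_
    rw [diffusion, Finset.mul_sum]
    exact Finset.sum_congr rfl fun j _ => by ring
  have h2 : ∑ i, z i * diffusion c z i = ∑ i, ∑ j, c i j * (z j * (z j - z i)) := by
    rw [h1, Finset.sum_comm]
    exact Finset.sum_congr rfl fun i _ => Finset.sum_congr rfl fun j _ => by rw [hc j i]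
  have h3 : 2 * energy c z = ∑ i, z i * diffusion c z i + ∑ i, z i * diffusion c z i := by
    conv_rhs => rw [h1]
    nth_rewrite 1 [← h1]
    rw [h2, ← h1, h2, energy]
    have : ∑ i, ∑ j, c i j * (z i - z j) ^ 2
        = ∑ i, ∑ j, c i j * (z i * (z i - z j)) + ∑ i, ∑ j, c i j * (z j * (z j - z i)) := by
      simp only [← Finset.sum_add_distrib]
      exact Finset.sum_congr rfl fun i _ => Finset.sum_congr rfl fun j _ => by ring
    rw [this, ← h1, h2]; ring
  linarith

/-- Cauchy–Schwarz, and $c^2\le c$ for weights in $[0,1]$. This controls the second-order term of an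
averaging step by the energy. -/
theorem sum_diffusion_sq_le {c : ι → ι → ℝ} (h0 : ∀ i j, 0 ≤ c i j) (h1 : ∀ i j, c i j ≤ 1)
    (z : ι → ℝ) : ∑ i, diffusion c z i ^ 2 ≤ 2 * Fintype.card ι * energy c z := by
  have key : ∀ i, diffusion c z i ^ 2 ≤ Fintype.card ι * ∑ j, c i j * (z i - z j) ^ 2 := by
    intro i
    have := sq_sum_le_card_mul_sum_sq (s := (Finset.univ : Finset ι))
      (f := fun j => c i j * (z i - z j))
    rw [diffusion]
    refine this.trans ?_
    rw [Finset.card_univ]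
    refine mul_le_mul_of_nonneg_left (Finset.sum_le_sum fun j _ => ?_) (by positivity)
    rw [mul_pow]
    have : c i j ^ 2 ≤ c i j := by nlinarith [h0 i j, h1 i j]
    nlinarith [sq_nonneg (z i - z j)]
  calc ∑ i, diffusion c z i ^ 2 ≤ ∑ i, Fintype.card ι * ∑ j, c i j * (z i - z j) ^ 2 :=
        Finset.sum_le_sum fun i _ => key i
    _ = 2 * Fintype.card ι * energy c z := by rw [← Finset.mul_sum, energy]; ring

theorem energy_nonneg {c : ι → ι → ℝ} (h0 : ∀ i j, 0 ≤ c i j) (z : ι → ℝ) : 0 ≤ energy c z := by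
  rw [energy]
  have := Finset.sum_nonneg fun i (_ : i ∈ Finset.univ) =>
    Finset.sum_nonneg fun j (_ : j ∈ Finset.univ) => mul_nonneg (h0 i j) (sq_nonneg (z i - z j))
  linarith

/-- One step of averaging with weights `c` and step size `β`. -/
noncomputable def averagingStep (c : ι → ι → ℝ) (β : ℝ) (z : ι → ℝ) : ι → ℝ :=
  z - β • diffusion c z

/-- Expanding the square gives a first-order gain $2\beta\cdot$energy; the small-step condition lets
half of it pay for the second-order term. -/
theorem norm_averagingStep_sq_le {c : ι → ι → ℝ} (hc : ∀ i j, c i j = c j i)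
    (h0 : ∀ i j, 0 ≤ c i j) (h1 : ∀ i j, c i j ≤ 1) {β : ℝ} (hβ : 0 ≤ β)
    (hβ1 : 2 * Fintype.card ι * β ≤ 1) (z : ι → ℝ) :
    ‖WithLp.toLp 2 (averagingStep c β z)‖ ^ 2 ≤ ‖WithLp.toLp 2 z‖ ^ 2 - β * energy c z := by
  rw [norm_toLp_sq, norm_toLp_sq]
  have h : ∑ i, averagingStep c β z i ^ 2
      = ∑ i, z i ^ 2 - 2 * β * ∑ i, z i * diffusion c z i + β ^ 2 * ∑ i, diffusion c z i ^ 2 := by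
    rw [Finset.mul_sum, Finset.mul_sum, ← Finset.sum_sub_distrib, ← Finset.sum_add_distrib]
    refine Finset.sum_congr rfl fun i _ => ?_
    simp only [averagingStep, Pi.sub_apply, Pi.smul_apply, smul_eq_mul]
    ring
  rw [h, sum_mul_diffusion hc]
  have h2 := sum_diffusion_sq_le h0 h1 z
  have h3 := energy_nonneg h0 z
  have h4 : β ^ 2 * ∑ i, diffusion c z i ^ 2 ≤ β ^ 2 * (2 * Fintype.card ι * energy c z) :=
    mul_le_mul_of_nonneg_left h2 (sq_nonneg β)
  have h5 : β * energy c z * (2 * Fintype.card ι * β) ≤ β * energy c z * 1 :=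
    mul_le_mul_of_nonneg_left hβ1 (mul_nonneg hβ h3)
  nlinarith

theorem norm_averagingStep_le {c : ι → ι → ℝ} (hc : ∀ i j, c i j = c j i)
    (h0 : ∀ i j, 0 ≤ c i j) (h1 : ∀ i j, c i j ≤ 1) {β : ℝ} (hβ : 0 ≤ β)
    (hβ1 : 2 * Fintype.card ι * β ≤ 1) (z : ι → ℝ) :
    ‖WithLp.toLp 2 (averagingStep c β z)‖ ≤ ‖WithLp.toLp 2 z‖ := by
  have := norm_averagingStep_sq_le hc h0 h1 hβ hβ1 z
  have h3 := mul_nonneg hβ (energy_nonneg h0 z)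
  exact abs_le_of_sq_le_sq' (by linarith) (norm_nonneg _) |>.2

theorem diffusion_linear (c : ι → ι → ℝ) {κ : Type*} (s : Finset κ) (a : κ → ℝ)
    (f : κ → ι → ℝ) : diffusion c (∑ k ∈ s, a k • f k) = ∑ k ∈ s, a k • diffusion c (f k) := by
  ext i
  simp only [diffusion, Finset.sum_apply, Pi.smul_apply, smul_eq_mul, Finset.mul_sum,
    ← Finset.sum_sub_distrib]
  rw [Finset.sum_comm]
  exact Finset.sum_congr rfl fun k _ => Finset.sum_congr rfl fun j _ => by ring

theorem averagingStep_linear (c : ι → ι → ℝ) (β : ℝ) {κ : Type*} (s : Finset κ) (a : κ → ℝ)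
    (f : κ → ι → ℝ) :
    averagingStep c β (∑ k ∈ s, a k • f k) = ∑ k ∈ s, a k • averagingStep c β (f k) := by
  simp only [averagingStep, diffusion_linear, Finset.smul_sum, ← Finset.sum_sub_distrib, smul_sub]
  exact Finset.sum_congr rfl fun k _ => by rw [smul_comm]

theorem averagingStep_sub (c : ι → ι → ℝ) (β : ℝ) (x y : ι → ℝ) :
    averagingStep c β (x - y) = averagingStep c β x - averagingStep c β y := by
  ext i
  simp only [averagingStep, diffusion, Pi.sub_apply, Pi.smul_apply, smul_eq_mul]
  have : ∑ j, c i j * (x i - y i - (x j - y j))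
      = ∑ j, c i j * (x i - x j) - ∑ j, c i j * (y i - y j) := by
    rw [← Finset.sum_sub_distrib]
    exact Finset.sum_congr rfl fun j _ => by ring
  rw [this]; ring

/-- `k` averaging steps, starting from `v` at time `s`. -/
noncomputable def flow (c : ℕ → ι → ι → ℝ) (β : ℕ → ℝ) (s : ℕ) (v : ι → ℝ) : ℕ → ι → ℝ
  | 0 => v
  | k + 1 => averagingStep (c (s + k)) (β (s + k)) (flow c β s v k)

theorem flow_linear (c : ℕ → ι → ι → ℝ) (β : ℕ → ℝ) (s k : ℕ) {κ : Type*} (S : Finset κ)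
    (a : κ → ℝ) (f : κ → ι → ℝ) :
    flow c β s (∑ q ∈ S, a q • f q) k = ∑ q ∈ S, a q • flow c β s (f q) k := by
  induction k with
  | zero => rfl
  | succ k ih => simp only [flow, ih, averagingStep_linear]

/-- Discrete Duhamel principle: averaging steps are nonexpansive, so perturbations at most add up.
-/
theorem norm_sub_flow_le {c : ℕ → ι → ι → ℝ} {β : ℕ → ℝ} (hc : ∀ t i j, c t i j = c t j i)
    (h0 : ∀ t i j, 0 ≤ c t i j) (h1 : ∀ t i j, c t i j ≤ 1) {s : ℕ} (hβ : ∀ t, 0 ≤ β t)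
    (hβ1 : ∀ t, s ≤ t → 2 * Fintype.card ι * β t ≤ 1) {d e : ℕ → ι → ℝ}
    (hd : ∀ t, d (t + 1) = averagingStep (c t) (β t) (d t) + e t) (k : ℕ) :
    ‖WithLp.toLp 2 (d (s + k) - flow c β s (d s) k)‖
      ≤ ∑ r ∈ Finset.range k, ‖WithLp.toLp 2 (e (s + r))‖ := by
  induction k with
  | zero => simp [flow]
  | succ k ih =>
    rw [Finset.sum_range_succ]
    have : d (s + (k + 1)) - flow c β s (d s) (k + 1)
        = averagingStep (c (s + k)) (β (s + k)) (d (s + k) - flow c β s (d s) k) + e (s + k) := by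
      rw [← add_assoc, hd, flow, averagingStep_sub]; abel
    rw [this, WithLp.toLp_add]
    refine (norm_add_le _ _).trans (add_le_add_left (le_trans ?_ ih) _)
    exact norm_averagingStep_le (hc _) (h0 _) (h1 _) (hβ _) (hβ1 _ (by omega)) _

/-- The projection onto the vectors supported on `J` with zero sum, applied to a vector supported
on `J`. -/
noncomputable def center [DecidableEq ι] (J : Finset ι) (z : ι → ℝ) : ι → ℝ :=
  fun i => if i ∈ J then z i - (∑ j ∈ J, z j) / J.card else 0

theorem sum_center [DecidableEq ι] (J : Finset ι) (z : ι → ℝ) : ∑ i, center J z i = 0 := by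
  simp only [center]
  rw [Finset.sum_ite_mem, Finset.univ_inter, Finset.sum_sub_distrib]
  rcases J.eq_empty_or_nonempty with rfl | hJ
  · simp
  · have : (J.card : ℝ) ≠ 0 := by exact_mod_cast hJ.card_pos.ne'
    simp; field_simp; simp

/-- Centering fixes $z$, so it may be applied termwise to the expansion of $z$ in the standard
basis. The spanning family is finite and deterministic, which lets almost sure statements about it
reach vectors that depend on the attack. -/
theorem eq_sum_center_single [DecidableEq ι] {J : Finset ι} {z : ι → ℝ} (hz : ∀ i, i ∉ J → z i = 0)
    (hs : ∑ i, z i = 0) : z = ∑ i, z i • center J (Pi.single i 1) := by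
  have hsJ : ∑ i ∈ J, z i = 0 := by
    rw [← hs]; exact Finset.sum_subset (Finset.subset_univ J) fun i _ hi => hz i hi
  ext i
  simp only [Finset.sum_apply, Pi.smul_apply, smul_eq_mul, center]
  by_cases hi : i ∈ J
  · simp only [hi, if_true, mul_sub, Finset.sum_sub_distrib]
    have h1 : ∑ x, z x * (∑ j ∈ J, (Pi.single x 1 : ι → ℝ) j / J.card) = 0 := by
      have : ∀ x, z x * (∑ j ∈ J, (Pi.single x 1 : ι → ℝ) j / J.card) = z x * (1 / J.card) := by
        intro x
        by_cases hx : x ∈ J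
        · have hone : ∑ j ∈ J, (Pi.single x 1 : ι → ℝ) j = 1 := by
            rw [Finset.sum_eq_single x]
            · simp
            · intro b _ hb; simp [hb]
            · exact fun h => absurd hx h
          rw [← Finset.sum_div, hone]
        · simp [hz x hx]
      simp only [this, ← Finset.sum_mul, hs, zero_mul]
    simp only [← Finset.sum_div] at h1
    rw [h1]
    simp [Pi.single_apply]
  · simp [hi, hz i hi]

theorem diffusion_eq_zero_of_notMem {J : Finset ι} {c : ι → ι → ℝ}
    (hJ : ∀ i j, i ∉ J → c i j = 0) (z : ι → ℝ) {i : ι} (hi : i ∉ J) : diffusion c z i = 0 := by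
  simp [diffusion, hJ i _ hi]

theorem averagingStep_support {J : Finset ι} {c : ι → ι → ℝ}
    (hJ : ∀ i j, i ∉ J → c i j = 0) (β : ℝ) {z : ι → ℝ} (hz : ∀ i, i ∉ J → z i = 0) {i : ι}
    (hi : i ∉ J) : averagingStep c β z i = 0 := by
  simp [averagingStep, hz i hi, diffusion_eq_zero_of_notMem hJ z hi]

theorem sum_averagingStep {c : ι → ι → ℝ} (hc : ∀ i j, c i j = c j i) (β : ℝ) (z : ι → ℝ) :
    ∑ i, averagingStep c β z i = ∑ i, z i := by
  simp [averagingStep, Finset.sum_sub_distrib, ← Finset.mul_sum, sum_diffusion hc]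

theorem flow_support {J : Finset ι} {c : ℕ → ι → ι → ℝ} (hJ : ∀ t i j, i ∉ J → c t i j = 0)
    (β : ℕ → ℝ) (s k : ℕ) {v : ι → ℝ} (hv : ∀ i, i ∉ J → v i = 0) (i : ι) (hi : i ∉ J) :
    flow c β s v k i = 0 := by
  induction k generalizing i with
  | zero => exact hv i hi
  | succ k ih => exact averagingStep_support (hJ _) _ ih hi

theorem sum_flow {c : ℕ → ι → ι → ℝ} (hc : ∀ t i j, c t i j = c t j i)
    (β : ℕ → ℝ) (s k : ℕ) (v : ι → ℝ) : ∑ i, flow c β s v k i = ∑ i, v i := by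
  induction k with
  | zero => rfl
  | succ k ih => rw [flow, sum_averagingStep (hc _), ih]

theorem norm_flow_le {c : ℕ → ι → ι → ℝ} {β : ℕ → ℝ} (hc : ∀ t i j, c t i j = c t j i)
    (h0 : ∀ t i j, 0 ≤ c t i j) (h1 : ∀ t i j, c t i j ≤ 1) {s : ℕ} (hβ : ∀ t, 0 ≤ β t)
    (hβ1 : ∀ t, s ≤ t → 2 * Fintype.card ι * β t ≤ 1) (v : ι → ℝ) (k : ℕ) :
    ‖WithLp.toLp 2 (flow c β s v k)‖ ≤ ‖WithLp.toLp 2 v‖ := by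
  induction k with
  | zero => rfl
  | succ k ih =>
    exact (norm_averagingStep_le (hc _) (h0 _) (h1 _) (hβ _) (hβ1 _ (by omega)) _).trans ih

/-- Diffusion within $J$ sees only differences and has zero sum, so it commutes with subtracting the
mean over $J$. -/
theorem center_averagingStep_add [DecidableEq ι] {J : Finset ι} {c : ι → ι → ℝ}
    (hc : ∀ i j, c i j = c j i) (hJ : ∀ i j, i ∉ J → c i j = 0) (β : ℝ) (z e : ι → ℝ) :
    center J (averagingStep c β z + e) = averagingStep c β (center J z) + center J e := by
  have hdz : diffusion c (center J z) = diffusion c z := by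
    ext i
    refine Finset.sum_congr rfl fun j _ => ?_
    by_cases hi : i ∈ J
    · by_cases hj : j ∈ J
      · simp [center, hi, hj]
      · simp [hc i j, hJ j i hj]
    · simp [hJ i j hi]
  have hsum : ∑ j ∈ J, diffusion c z j = 0 := by
    rw [← sum_diffusion hc z]
    exact Finset.sum_subset (Finset.subset_univ J)
      fun i _ hi => diffusion_eq_zero_of_notMem hJ z hi
  ext i
  by_cases hi : i ∈ J
  · simp only [averagingStep, hdz, center, hi, if_true, Pi.add_apply, Pi.sub_apply, Pi.smul_apply,
      smul_eq_mul, Finset.sum_add_distrib, Finset.sum_sub_distrib, ← Finset.mul_sum, hsum]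
    ring
  · simp [averagingStep, hdz, center, hi, diffusion_eq_zero_of_notMem hJ z hi]

end Diffusion

/-! ### Rayleigh bounds for the smallest and second smallest eigenvalue -/

section Spectral

variable {ι : Type*} [Fintype ι] [DecidableEq ι]

theorem dotProduct_eigenvectorBasis_mulVec {A : Matrix ι ι ℝ} (hA : A.IsHermitian) (z : ι → ℝ)
    (i : ι) : (hA.eigenvectorBasis i).ofLp ⬝ᵥ A.mulVec z
      = hA.eigenvalues i * ((hA.eigenvectorBasis i).ofLp ⬝ᵥ z) := by
  have hsymm : A.transpose = A := by
    rw [← Matrix.conjTranspose_eq_transpose_of_trivial]; exact hA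
  rw [Matrix.dotProduct_mulVec, ← Matrix.mulVec_transpose, hsymm, hA.mulVec_eigenvectorBasis,
    smul_dotProduct, smul_eq_mul]

theorem sum_dotProduct_eigenvectorBasis {A : Matrix ι ι ℝ} (hA : A.IsHermitian) (x y : ι → ℝ) :
    ∑ i, ((hA.eigenvectorBasis i).ofLp ⬝ᵥ x) * ((hA.eigenvectorBasis i).ofLp ⬝ᵥ y) = x ⬝ᵥ y := by
  have := hA.eigenvectorBasis.sum_inner_mul_inner (WithLp.toLp 2 x) (WithLp.toLp 2 y)
  simp only [EuclideanSpace.inner_eq_star_dotProduct, star_trivial] at this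
  rw [dotProduct_comm x y, ← this]
  refine Finset.sum_congr rfl fun i _ => ?_
  rw [dotProduct_comm y]

theorem dotProduct_mulVec_eq_sum {A : Matrix ι ι ℝ} (hA : A.IsHermitian) (z : ι → ℝ) :
    z ⬝ᵥ A.mulVec z = ∑ i, hA.eigenvalues i * ((hA.eigenvectorBasis i).ofLp ⬝ᵥ z) ^ 2 := by
  rw [← sum_dotProduct_eigenvectorBasis hA]
  refine Finset.sum_congr rfl fun i _ => ?_
  rw [dotProduct_eigenvectorBasis_mulVec]; ring

theorem lambdaMin_mul_le {A : Matrix ι ι ℝ} (hA : A.IsHermitian) (z : ι → ℝ) :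
    lambdaMin hA * ∑ i, z i ^ 2 ≤ z ⬝ᵥ A.mulVec z := by
  have h : ∑ i, z i ^ 2 = z ⬝ᵥ z := by simp [dotProduct, sq]
  rw [h, dotProduct_mulVec_eq_sum hA, ← sum_dotProduct_eigenvectorBasis hA, Finset.mul_sum]
  refine Finset.sum_le_sum fun i _ => ?_
  rw [← sq]
  exact mul_le_mul_of_nonneg_right (ciInf_le (Set.finite_range _).bddBelow i) (sq_nonneg _)

/-- The vector $1$ lies in the kernel, hence is orthogonal to all eigenvectors with positive
eigenvalue. As all eigenvalues but the last are at least $\lambda_2>0$, it spans the last eigenline,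
and a zero-sum $z$ has no component there. -/
theorem lambdaTwo_mul_le {A : Matrix ι ι ℝ} (hA : A.IsHermitian) (hcard : 2 ≤ Fintype.card ι)
    (hpos : 0 < lambdaTwo hA hcard) (hone : A.mulVec 1 = 0) {z : ι → ℝ} (hz : ∑ i, z i = 0) :
    lambdaTwo hA hcard * ∑ i, z i ^ 2 ≤ z ⬝ᵥ A.mulVec z := by
  set e : Fin (Fintype.card ι) ≃ ι := Fintype.equivOfCardEq (Fintype.card_fin _) with he
  -- Eigenvalues are listed in decreasing order through `e`, so this index carries the smallest one.
  set i₀ : ι := e ⟨Fintype.card ι - 1, by omega⟩ with hi₀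
  have hge : ∀ i, i ≠ i₀ → lambdaTwo hA hcard ≤ hA.eigenvalues i := by
    intro i hi
    refine hA.eigenvalues₀_antitone ?_
    have h1 : e.symm i ≠ ⟨Fintype.card ι - 1, by omega⟩ := fun h => hi (by rw [hi₀, ← h]; simp)
    rw [Fin.le_def]
    have h2 := (e.symm i).2
    have h3 : (e.symm i).1 ≠ Fintype.card ι - 1 := fun h => h1 (Fin.ext h)
    simp only [← he]
    omega
  have h0 : ∀ i, i ≠ i₀ → (hA.eigenvectorBasis i).ofLp ⬝ᵥ (1 : ι → ℝ) = 0 := by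
    intro i hi
    have h1 := dotProduct_eigenvectorBasis_mulVec hA 1 i
    rw [hone, dotProduct_zero] at h1
    rcases mul_eq_zero.1 h1.symm with h | h
    · exact absurd h (hpos.trans_le (hge i hi)).ne'
    · exact h
  have hsum : ∀ y : ι → ℝ, ((hA.eigenvectorBasis i₀).ofLp ⬝ᵥ (1 : ι → ℝ))
      * ((hA.eigenvectorBasis i₀).ofLp ⬝ᵥ y) = 1 ⬝ᵥ y := by
    intro y
    rw [← sum_dotProduct_eigenvectorBasis hA 1 y, Finset.sum_eq_single i₀]
    · intro i _ hi; rw [h0 i hi, zero_mul]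
    · simp
  have hne : (hA.eigenvectorBasis i₀).ofLp ⬝ᵥ (1 : ι → ℝ) ≠ 0 := by
    intro h
    have h1 := hsum 1
    rw [h, zero_mul] at h1
    simp only [dotProduct, Pi.one_apply, mul_one, Finset.sum_const, Finset.card_univ,
      nsmul_eq_mul] at h1
    have : Fintype.card ι = 0 := by exact_mod_cast h1.symm
    omega
  have hz0 : (hA.eigenvectorBasis i₀).ofLp ⬝ᵥ z = 0 := by
    have h1 := hsum z
    have h2 : (1 : ι → ℝ) ⬝ᵥ z = 0 := by simpa [dotProduct] using hz
    rw [h2] at h1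
    exact (mul_eq_zero.1 h1).resolve_left hne
  have h : ∑ i, z i ^ 2 = z ⬝ᵥ z := by simp [dotProduct, sq]
  rw [h, dotProduct_mulVec_eq_sum hA, ← sum_dotProduct_eigenvectorBasis hA, Finset.mul_sum]
  refine Finset.sum_le_sum fun i _ => ?_
  by_cases hi : i = i₀
  · rw [hi, hz0]; simp
  · rw [← sq]
    exact mul_le_mul_of_nonneg_right (hge i hi) (sq_nonneg _)

end Spectral

/-! ### Edge weights of induced subgraphs and the gap of the mean Laplacian -/

section Weights

variable {N : ℕ}

open Classical in
/-- The edge weights of the subgraph of `G` induced by `J`. -/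
noncomputable def edgeWeight (J : Finset (Fin N)) (G : SimpleGraph (Fin N)) (i j : Fin N) : ℝ :=
  if G.Adj i j ∧ i ∈ J ∧ j ∈ J then 1 else 0

theorem edgeWeight_comm (J : Finset (Fin N)) (G : SimpleGraph (Fin N)) (i j : Fin N) :
    edgeWeight J G i j = edgeWeight J G j i := by
  have h : (G.Adj i j ∧ i ∈ J ∧ j ∈ J) ↔ (G.Adj j i ∧ j ∈ J ∧ i ∈ J) := by
    rw [G.adj_comm, and_comm (a := i ∈ J)]
  unfold edgeWeight
  split_ifs <;> tauto

theorem edgeWeight_nonneg (J : Finset (Fin N)) (G : SimpleGraph (Fin N)) (i j : Fin N) :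
    0 ≤ edgeWeight J G i j := by
  unfold edgeWeight; split_ifs <;> norm_num

theorem edgeWeight_le_one (J : Finset (Fin N)) (G : SimpleGraph (Fin N)) (i j : Fin N) :
    edgeWeight J G i j ≤ 1 := by
  unfold edgeWeight; split_ifs <;> norm_num

theorem edgeWeight_eq_zero {J : Finset (Fin N)} (G : SimpleGraph (Fin N)) {i : Fin N} (j : Fin N)
    (hi : i ∉ J) : edgeWeight J G i j = 0 := by
  simp [edgeWeight, hi]

/-- The edge weights as a function of the entries of the Laplacian. -/
def weightOfEntries (J : Finset (Fin N)) (i j : Fin N) (L : Fin N → Fin N → ℝ) : ℝ :=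
  if i ≠ j ∧ i ∈ J ∧ j ∈ J then -L i j else 0

/-- Through this identity the measurability, independence and common law assumed of the Laplacians
pass to the edge weights. -/
theorem weightOfEntries_laplacianEntries (J : Finset (Fin N)) (G : SimpleGraph (Fin N))
    (i j : Fin N) : weightOfEntries J i j (laplacianEntries G) = edgeWeight J G i j := by
  classical
  by_cases h : i = j
  · subst h; simp [weightOfEntries, edgeWeight]
  · by_cases hJ : i ∈ J ∧ j ∈ J
    · simp only [weightOfEntries, edgeWeight, hJ, laplacianEntries, laplacian,
        SimpleGraph.lapMatrix, SimpleGraph.degMatrix, Matrix.sub_apply,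
        Matrix.diagonal_apply_ne _ h, SimpleGraph.adjMatrix_apply]
      simp [h]
    · simp [weightOfEntries, edgeWeight, hJ]

theorem measurable_weightOfEntries (J : Finset (Fin N)) (i j : Fin N) :
    Measurable (weightOfEntries J i j) := by
  unfold weightOfEntries
  split_ifs
  · fun_prop
  · exact measurable_const

theorem inducedLaplacian_apply (J : Finset (Fin N)) (G : SimpleGraph (Fin N)) (i j : J) :
    inducedLaplacian J G i j
      = (if i = j then ∑ l : J, edgeWeight J G i l else 0) - edgeWeight J G i j := by
  classical
  simp only [inducedLaplacian, laplacian, SimpleGraph.lapMatrix, SimpleGraph.degMatrix,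
    Matrix.sub_apply, SimpleGraph.adjMatrix_apply, edgeWeight, Matrix.diagonal_apply]
  congr 1
  · split_ifs with h
    · rw [← SimpleGraph.card_neighborFinset_eq_degree, Finset.card_eq_sum_ones,
        SimpleGraph.neighborFinset_eq_filter, Finset.sum_filter]
      push_cast
      refine Finset.sum_congr rfl fun l _ => ?_
      simp [SimpleGraph.comap_adj]
    · rfl
  · simp [SimpleGraph.comap_adj]

variable {Ω : Type*} [MeasurableSpace Ω] {μ : Measure Ω}

theorem measurable_edgeWeight {G : Ω → SimpleGraph (Fin N)}
    (hG : Measurable fun ω => laplacianEntries (G ω)) (J : Finset (Fin N)) (i j : Fin N) :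
    Measurable fun ω => edgeWeight J (G ω) i j := by
  simp only [← weightOfEntries_laplacianEntries]
  exact (measurable_weightOfEntries J i j).comp hG

theorem integrable_edgeWeight [IsFiniteMeasure μ] {G : Ω → SimpleGraph (Fin N)}
    (hG : Measurable fun ω => laplacianEntries (G ω)) (J : Finset (Fin N)) (i j : Fin N) :
    Integrable (fun ω => edgeWeight J (G ω) i j) μ :=
  Integrable.of_bound (measurable_edgeWeight hG J i j).aestronglyMeasurable 1
    (Eventually.of_forall fun ω => by
      rw [Real.norm_of_nonneg (edgeWeight_nonneg _ _ _ _)]; exact edgeWeight_le_one _ _ _ _)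

theorem meanInducedLaplacian_mulVec [IsFiniteMeasure μ] {G : Ω → SimpleGraph (Fin N)}
    (hG : Measurable fun ω => laplacianEntries (G ω)) (J : Finset (Fin N)) (z : J → ℝ) :
    (meanInducedLaplacian μ J G).mulVec z
      = diffusion (fun i j : J => ∫ ω, edgeWeight J (G ω) i j ∂μ) z := by
  have hint := fun i j => integrable_edgeWeight (μ := μ) hG J i j
  have hentry : ∀ i j : J, meanInducedLaplacian μ J G i j
      = (if i = j then ∑ l : J, ∫ ω, edgeWeight J (G ω) i l ∂μ else 0)
        - ∫ ω, edgeWeight J (G ω) i j ∂μ := by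
    intro i j
    simp only [meanInducedLaplacian, Matrix.of_apply, inducedLaplacian_apply]
    split_ifs with h
    · rw [integral_sub (integrable_finsetSum _ fun l _ => hint _ _) (hint _ _),
        integral_finsetSum _ fun l _ => hint _ _]
    · simp [integral_neg]
  ext i
  simp only [Matrix.mulVec, dotProduct, hentry, diffusion, sub_mul, Finset.sum_sub_distrib,
    mul_sub, ite_mul, zero_mul, Finset.sum_ite_eq, Finset.mem_univ, if_true, Finset.sum_mul]

theorem exists_spectralGap [IsFiniteMeasure μ] {G : Ω → SimpleGraph (Fin N)}
    (hG : Measurable fun ω => laplacianEntries (G ω)) (J : Finset (Fin N))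
    (hconn : ConnectedOnAverage μ J G) :
    ∃ lam : ℝ, 0 < lam ∧ ∀ z : Fin N → ℝ, (∀ i, i ∉ J → z i = 0) → ∑ i, z i = 0 →
      lam * ‖WithLp.toLp 2 z‖ ^ 2 ≤ energy (fun i j => ∫ ω, edgeWeight J (G ω) i j ∂μ) z := by
  have hnonneg : ∀ i j, 0 ≤ ∫ ω, edgeWeight J (G ω) i j ∂μ :=
    fun i j => integral_nonneg fun ω => edgeWeight_nonneg _ _ _ _
  have hsumJ : ∀ f : Fin N → ℝ, (∀ i, i ∉ J → f i = 0) → ∑ i : J, f i = ∑ i, f i := by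
    intro f hf
    rw [Finset.sum_coe_sort J f]
    exact Finset.sum_subset (Finset.subset_univ J) fun i _ hi => hf i hi
  by_cases hcard : 2 ≤ Fintype.card J
  · refine ⟨_, hconn hcard, fun z hz hs => ?_⟩
    have hone : (meanInducedLaplacian μ J G).mulVec 1 = 0 := by
      rw [meanInducedLaplacian_mulVec hG]; ext i; simp [diffusion]
    have h := lambdaTwo_mul_le (meanInducedLaplacian_isHermitian μ J G) hcard (hconn hcard) hone
      (z := fun i : J => z i) (by rw [hsumJ z hz, hs])
    rw [meanInducedLaplacian_mulVec hG] at h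
    have h2 := sum_mul_diffusion (c := fun i j : J => ∫ ω, edgeWeight J (G ω) i j ∂μ)
      (fun i j => by simp only [edgeWeight_comm J _ i j]) (fun i : J => z i)
    rw [dotProduct, h2, hsumJ (fun i => z i ^ 2) (fun i hi => by simp [hz i hi])] at h
    rw [norm_toLp_sq]
    refine h.trans (le_of_eq ?_)
    unfold energy
    congr 1
    rw [← hsumJ]
    · refine Finset.sum_congr rfl fun i _ => ?_
      rw [← hsumJ (fun j => (∫ ω, edgeWeight J (G ω) i j ∂μ) * (z i - z j) ^ 2)]
      intro j hj
      simp [edgeWeight_comm J _ i j, edgeWeight_eq_zero _ _ hj]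
    · intro i hi
      simp [edgeWeight_eq_zero _ _ hi]
  -- With at most one vertex the only zero-sum vector supported on $J$ is zero, so any positive
  -- constant serves.
  · refine ⟨1, one_pos, fun z hz hs => ?_⟩
    have hz0 : z = 0 := by
      ext i
      by_cases hi : i ∈ J
      · rw [Fintype.card_coe] at hcard
        have h1 : J = {i} := by
          refine Finset.eq_singleton_iff_unique_mem.2 ⟨hi, fun j hj => ?_⟩
          exact Finset.card_le_one.1 (by omega) j hj i hi
        rw [← Finset.sum_eq_single (s := Finset.univ) i (f := z)]
        · exact hs
        · intro j _ hj; exact hz j (by rw [h1]; simpa using hj)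
        · simp
      · exact hz i hi
    rw [hz0]
    simp [energy]

end Weights

/-! ### Mean-square contraction of random averaging -/

section MeanContraction

variable {N : ℕ} {Ω : Type*}

theorem measurable_averagingStep {ι : Type*} [Fintype ι] {m : MeasurableSpace Ω}
    {c : Ω → ι → ι → ℝ} (hc : ∀ i j, Measurable fun ω => c ω i j) (β : ℝ) {z : Ω → ι → ℝ}
    (hz : Measurable z) : Measurable fun ω => averagingStep (c ω) β (z ω) := by
  have hz' : ∀ i, Measurable fun ω => z ω i := fun i => measurable_pi_iff.1 hz i
  refine measurable_pi_iff.2 fun i => ?_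
  simp only [averagingStep, diffusion, Pi.sub_apply, Pi.smul_apply, smul_eq_mul]
  exact (hz' i).sub ((Finset.measurable_sum _ fun j _ =>
    (hc i j).mul ((hz' i).sub (hz' j))).const_mul β)

/-- The energy is linear in the weights, and these are independent of $z$. Its mean is therefore
unchanged when the weights are replaced by their means, to which the spectral gap applies. -/
theorem integral_averagingStep_le {m : MeasurableSpace Ω} [m0 : MeasurableSpace Ω] {μ : Measure Ω} [IsProbabilityMeasure μ] {G : Ω → SimpleGraph (Fin N)}
    (hG : Measurable fun ω => laplacianEntries (G ω)) {J : Finset (Fin N)} {lam : ℝ}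
    (hgap : ∀ z : Fin N → ℝ, (∀ i, i ∉ J → z i = 0) → ∑ i, z i = 0 →
      lam * ‖WithLp.toLp 2 z‖ ^ 2 ≤ energy (fun i j => ∫ ω, edgeWeight J (G ω) i j ∂μ) z)
    (hm : m ≤ m0)
    (hind : Indep (MeasurableSpace.comap (fun ω => laplacianEntries (G ω)) inferInstance) m μ)
    {z : Ω → Fin N → ℝ} (hz : Measurable[m] z) {B : ℝ} (hB : ∀ ω, ‖WithLp.toLp 2 (z ω)‖ ≤ B)
    (hsupp : ∀ ω i, i ∉ J → z ω i = 0) (hsum : ∀ ω, ∑ i, z ω i = 0) {β : ℝ} (hβ : 0 ≤ β)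
    (hβ1 : 2 * Fintype.card (Fin N) * β ≤ 1) :
    ∫ ω, ‖WithLp.toLp 2 (averagingStep (edgeWeight J (G ω)) β (z ω))‖ ^ 2 ∂μ
      ≤ (1 - β * lam) * ∫ ω, ‖WithLp.toLp 2 (z ω)‖ ^ 2 ∂μ := by
  have hz0 : Measurable z := hz.mono hm le_rfl
  have hzi : ∀ i, Measurable fun ω => z ω i := fun i => measurable_pi_iff.1 hz0 i
  have hmeasn : ∀ {f : Ω → Fin N → ℝ}, Measurable f →
      Measurable fun ω => ‖WithLp.toLp 2 (f ω)‖ ^ 2 := by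
    intro f hf
    simp only [norm_toLp_sq]
    exact Finset.measurable_sum _ fun i _ => (measurable_pi_iff.1 hf i).pow_const 2
  have hintn : ∀ {f : Ω → Fin N → ℝ}, Measurable f → (∀ ω, ‖WithLp.toLp 2 (f ω)‖ ≤ B) →
      Integrable (fun ω => ‖WithLp.toLp 2 (f ω)‖ ^ 2) μ := by
    intro f hf hfB
    refine Integrable.of_bound (hmeasn hf).aestronglyMeasurable (B ^ 2)
      (Eventually.of_forall fun ω => ?_)
    rw [Real.norm_of_nonneg (sq_nonneg _)]
    exact pow_le_pow_left₀ (norm_nonneg _) (hfB ω) 2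
  have hstepm : Measurable fun ω => averagingStep (edgeWeight J (G ω)) β (z ω) :=
    measurable_averagingStep (fun i j => measurable_edgeWeight hG J i j) β hz0
  have hstepB : ∀ ω, ‖WithLp.toLp 2 (averagingStep (edgeWeight J (G ω)) β (z ω))‖ ≤ B :=
    fun ω => (norm_averagingStep_le (edgeWeight_comm _ _) (edgeWeight_nonneg _ _)
      (edgeWeight_le_one _ _) hβ hβ1 _).trans (hB ω)
  have hdiffint : ∀ i j, Integrable (fun ω => (z ω i - z ω j) ^ 2) μ := by
    intro i j
    refine Integrable.of_bound (((hzi i).sub (hzi j)).pow_const 2).aestronglyMeasurable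
      ((B + B) ^ 2) (Eventually.of_forall fun ω => ?_)
    rw [Real.norm_of_nonneg (sq_nonneg _), ← sq_abs]
    refine pow_le_pow_left₀ (abs_nonneg _) ((abs_sub _ _).trans (add_le_add ?_ ?_)) 2
    · exact (abs_le_norm_toLp _ i).trans (hB ω)
    · exact (abs_le_norm_toLp _ j).trans (hB ω)
  have hprod : ∀ i j, IndepFun (fun ω => edgeWeight J (G ω) i j)
      (fun ω => (z ω i - z ω j) ^ 2) μ := by
    intro i j
    rw [IndepFun_iff_Indep]
    refine indep_of_indep_of_le_left (indep_of_indep_of_le_right hind ?_) ?_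
    · refine Measurable.comap_le ?_
      have hzi : ∀ i, Measurable[m] fun ω => z ω i :=
        fun i => (measurable_pi_apply i).comp hz
      exact ((hzi i).sub (hzi j)).pow_const 2
    · simp only [← weightOfEntries_laplacianEntries]
      exact Measurable.comap_le ((measurable_weightOfEntries J i j).comp (comap_measurable _))
  have hprodint : ∀ i j, Integrable (fun ω => edgeWeight J (G ω) i j * (z ω i - z ω j) ^ 2) μ :=
    fun i j => (hprod i j).integrable_mul (integrable_edgeWeight hG J i j) (hdiffint i j)
  have henergy : ∫ ω, energy (edgeWeight J (G ω)) (z ω) ∂μ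
      = ∫ ω, energy (fun i j => ∫ ω, edgeWeight J (G ω) i j ∂μ) (z ω) ∂μ := by
    simp only [energy]
    rw [integral_const_mul, integral_const_mul]
    congr 1
    rw [integral_finsetSum _ fun i _ => integrable_finsetSum _ fun j _ => hprodint i j,
      integral_finsetSum _ fun i _ => integrable_finsetSum _ fun j _ => (hdiffint i j).const_mul _]
    refine Finset.sum_congr rfl fun i _ => ?_
    rw [integral_finsetSum _ fun j _ => hprodint i j,
      integral_finsetSum _ fun j _ => (hdiffint i j).const_mul _]
    refine Finset.sum_congr rfl fun j _ => ?_
    rw [integral_const_mul]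
    exact (hprod i j).integral_fun_mul_eq_mul_integral
      (measurable_edgeWeight hG J i j).aestronglyMeasurable (hdiffint i j).aestronglyMeasurable
  have henint : Integrable (fun ω => energy (edgeWeight J (G ω)) (z ω)) μ := by
    simp only [energy]
    exact (integrable_finsetSum _ fun i _ => integrable_finsetSum _ fun j _ => hprodint i j).const_mul _
  have henint' : Integrable
      (fun ω => energy (fun i j => ∫ ω, edgeWeight J (G ω) i j ∂μ) (z ω)) μ := by
    simp only [energy]
    exact (integrable_finsetSum _ fun i _ => integrable_finsetSum _ fun j _ =>
      (hdiffint i j).const_mul _).const_mul _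
  have h1 : ∫ ω, ‖WithLp.toLp 2 (averagingStep (edgeWeight J (G ω)) β (z ω))‖ ^ 2 ∂μ
      ≤ ∫ ω, (‖WithLp.toLp 2 (z ω)‖ ^ 2 - β * energy (edgeWeight J (G ω)) (z ω)) ∂μ :=
    integral_mono (hintn hstepm hstepB) ((hintn hz0 hB).sub (henint.const_mul β)) fun ω =>
      norm_averagingStep_sq_le (edgeWeight_comm _ _) (edgeWeight_nonneg _ _)
        (edgeWeight_le_one _ _) hβ hβ1 _
  rw [integral_sub (hintn hz0 hB) (henint.const_mul β), integral_const_mul, henergy] at h1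
  have h2 : lam * ∫ ω, ‖WithLp.toLp 2 (z ω)‖ ^ 2 ∂μ
      ≤ ∫ ω, energy (fun i j => ∫ ω, edgeWeight J (G ω) i j ∂μ) (z ω) ∂μ := by
    rw [← integral_const_mul]
    exact integral_mono ((hintn hz0 hB).const_mul _) henint' fun ω => hgap _ (hsupp ω) (hsum ω)
  nlinarith [mul_le_mul_of_nonneg_left h2 hβ]

variable {P : Fin N → ℕ} {G : ℕ → Ω → SimpleGraph (Fin N)} {w : ∀ n : Fin N, ℕ → Ω → Fin (P n) → ℝ}

theorem history_le [m0 : MeasurableSpace Ω] (hG : ∀ t, Measurable fun ω => laplacianEntries (G t ω))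
    (hw : ∀ n t, Measurable (w n t)) (t : ℕ) : history G w t ≤ m0 :=
  iSup_le fun s => sup_le (hG s).comap_le (iSup_le fun n => (hw n s).comap_le)

theorem history_mono : Monotone (history G w) := by
  intro s t hst
  refine iSup_le fun r => ?_
  exact le_iSup (fun s : Fin t => (MeasurableSpace.comap (fun ω => laplacianEntries (G s ω))
    inferInstance ⊔ ⨆ n, MeasurableSpace.comap (w n s) inferInstance)) ⟨r, r.2.trans_le hst⟩

theorem measurable_history_laplacian {s t : ℕ} (h : s < t) :
    Measurable[history G w t] fun ω => laplacianEntries (G s ω) :=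
  Measurable.of_comap_le (le_trans le_sup_left (le_iSup (fun s : Fin t =>
    (MeasurableSpace.comap (fun ω => laplacianEntries (G s ω))
    inferInstance ⊔ ⨆ n, MeasurableSpace.comap (w n s) inferInstance)) ⟨s, h⟩))

theorem measurable_history_noise {s t : ℕ} (h : s < t) (n : Fin N) :
    Measurable[history G w t] (w n s) :=
  Measurable.of_comap_le (le_trans (le_trans (le_iSup (fun n => MeasurableSpace.comap (w n s)
    inferInstance) n) le_sup_right) (le_iSup (fun s : Fin t =>
    (MeasurableSpace.comap (fun ω => laplacianEntries (G s ω))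
    inferInstance ⊔ ⨆ n, MeasurableSpace.comap (w n s) inferInstance)) ⟨s, h⟩))

theorem measurable_flow (J : Finset (Fin N)) (β : ℕ → ℝ) (s : ℕ) (v : Fin N → ℝ) (k : ℕ) :
    Measurable[history G w (s + k)] fun ω => flow (fun t => edgeWeight J (G t ω)) β s v k := by
  induction k with
  | zero => exact measurable_const
  | succ k ih =>
    refine measurable_averagingStep (fun i j => ?_) _
      (ih.mono (history_mono (by omega)) le_rfl)
    simp only [← weightOfEntries_laplacianEntries]
    exact (measurable_weightOfEntries J i j).comp
      (measurable_history_laplacian (w := w) (by omega : s + k < s + (k + 1)))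

/-- The starting vector is deterministic, so the flow at each time depends only on past graphs and
the one-step contraction iterates, with $1-x\le e^{-x}$. -/
theorem integral_flow_le [MeasurableSpace Ω] {μ : Measure Ω} [IsProbabilityMeasure μ]
    (hG : ∀ t, Measurable fun ω => laplacianEntries (G t ω)) (hw : ∀ n t, Measurable (w n t))
    (hG_past : ∀ t, Indep
      (MeasurableSpace.comap (fun ω => laplacianEntries (G t ω)) inferInstance) (history G w t) μ)
    {J : Finset (Fin N)} {lam : ℝ}
    (hgap : ∀ t, ∀ z : Fin N → ℝ, (∀ i, i ∉ J → z i = 0) → ∑ i, z i = 0 →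
      lam * ‖WithLp.toLp 2 z‖ ^ 2 ≤ energy (fun i j => ∫ ω, edgeWeight J (G t ω) i j ∂μ) z)
    {β : ℕ → ℝ} {s : ℕ} (hβ : ∀ t, 0 ≤ β t)
    (hβ1 : ∀ t, s ≤ t → 2 * Fintype.card (Fin N) * β t ≤ 1)
    {v : Fin N → ℝ} (hv : ∀ i, i ∉ J → v i = 0) (hvs : ∑ i, v i = 0) (k : ℕ) :
    ∫ ω, ‖WithLp.toLp 2 (flow (fun t => edgeWeight J (G t ω)) β s v k)‖ ^ 2 ∂μ
      ≤ Real.exp (-(lam * ∑ r ∈ Finset.range k, β (s + r))) * ‖WithLp.toLp 2 v‖ ^ 2 := by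
  induction k with
  | zero => simp [flow]
  | succ k ih =>
    have h := integral_averagingStep_le (hG (s + k)) (hgap (s + k)) (history_le hG hw (s + k))
      (hG_past (s + k)) (measurable_flow J β s v k) (B := ‖WithLp.toLp 2 v‖)
      (fun ω => norm_flow_le (fun t => edgeWeight_comm _ _) (fun t => edgeWeight_nonneg _ _)
        (fun t => edgeWeight_le_one _ _) hβ hβ1 v k)
      (fun ω => flow_support (fun t i j hi => edgeWeight_eq_zero _ _ hi) β s k hv)
      (fun ω => by rw [sum_flow (fun t => edgeWeight_comm _ _), hvs]) (hβ (s + k))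
      (hβ1 _ (by omega))
    refine h.trans ?_
    rw [Finset.sum_range_succ]
    have h1 : 1 - β (s + k) * lam ≤ Real.exp (-(β (s + k) * lam)) := by
      have := Real.add_one_le_exp (-(β (s + k) * lam)); linarith
    have h0 : 0 ≤ ∫ ω, ‖WithLp.toLp 2 (flow (fun t => edgeWeight J (G t ω)) β s v k)‖ ^ 2 ∂μ :=
      integral_nonneg fun ω => sq_nonneg _
    calc _ ≤ Real.exp (-(β (s + k) * lam)) * (Real.exp (-(lam * ∑ r ∈ Finset.range k, β (s + r)))
          * ‖WithLp.toLp 2 v‖ ^ 2) :=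
          (mul_le_mul_of_nonneg_right h1 h0).trans
            (mul_le_mul_of_nonneg_left ih (Real.exp_pos _).le)
      _ = _ := by
          rw [← mul_assoc, ← Real.exp_add]; congr 2; ring

/-- The series of the $X_t$, from some index on, has finite expectation, so it converges almost
surely and its terms vanish. -/
theorem ae_tendsto_zero_of_summable_integral [MeasurableSpace Ω] {μ : Measure Ω} {X : ℕ → Ω → ℝ} (h0 : ∀ t ω, 0 ≤ X t ω)
    (hX : ∀ t, Integrable (X t) μ) {g : ℕ → ℝ} (hg : Summable g)
    (hXg : ∀ᶠ t in atTop, ∫ ω, X t ω ∂μ ≤ g t) :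
    ∀ᵐ ω ∂μ, Tendsto (fun t => X t ω) atTop (𝓝 0) := by
  obtain ⟨T, hT⟩ := eventually_atTop.1 hXg
  have hle : ∀ t, ∫⁻ ω, ENNReal.ofReal (X (t + T) ω) ∂μ ≤ ENNReal.ofReal (g (t + T)) := by
    intro t
    rw [← ofReal_integral_eq_lintegral_ofReal (hX _) (Eventually.of_forall (h0 _))]
    exact ENNReal.ofReal_le_ofReal (hT _ (by omega))
  have hg0 : ∀ t, 0 ≤ g (t + T) := fun t =>
    (integral_nonneg (h0 _)).trans (hT _ (by omega))
  have hfin : ∫⁻ ω, ∑' t, ENNReal.ofReal (X (t + T) ω) ∂μ ≠ ⊤ := by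
    rw [lintegral_tsum fun t => (hX _).aestronglyMeasurable.aemeasurable.ennreal_ofReal]
    refine ne_top_of_le_ne_top ?_ (ENNReal.tsum_le_tsum hle)
    exact ((summable_nat_add_iff T).2 hg).tsum_ofReal_ne_top
  have hae := ae_lt_top' (AEMeasurable.tsum fun t =>
    (hX (t + T)).aestronglyMeasurable.aemeasurable.ennreal_ofReal) hfin
  filter_upwards [hae] with ω hω
  have h1 := ENNReal.tendsto_atTop_zero_of_tsum_ne_top hω.ne
  have h2 := (ENNReal.tendsto_toReal ENNReal.zero_ne_top).comp h1
  rw [← tendsto_add_atTop_iff_nat T]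
  refine h2.congr fun t => ?_
  simp [ENNReal.toReal_ofReal (h0 _ _)]

end MeanContraction

/-! ### Polynomial sequences and window lengths -/

section Rates

theorem tendsto_natCast_add_one : Tendsto (fun t : ℕ => (t : ℝ) + 1) atTop atTop :=
  tendsto_atTop_add_const_right _ _ tendsto_natCast_atTop_atTop

theorem tendsto_add_one_rpow_neg {η : ℝ} (hη : 0 < η) :
    Tendsto (fun t : ℕ => ((t : ℝ) + 1) ^ (-η)) atTop (𝓝 0) :=
  (tendsto_rpow_neg_atTop hη).comp tendsto_natCast_add_one

/-- The length of the time window over which the network forgets its past. -/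
noncomputable def window (ρ : ℝ) (t : ℕ) : ℕ := ⌈((t : ℝ) + 1) ^ ρ⌉₊

theorem rpow_le_window (ρ : ℝ) (t : ℕ) : ((t : ℝ) + 1) ^ ρ ≤ window ρ t := Nat.le_ceil _

theorem window_le {ρ : ℝ} (hρ : 0 ≤ ρ) (t : ℕ) : (window ρ t : ℝ) ≤ 2 * ((t : ℝ) + 1) ^ ρ := by
  have h1 : (1 : ℝ) ≤ ((t : ℝ) + 1) ^ ρ := Real.one_le_rpow (by linarith [t.cast_nonneg (α := ℝ)]) hρ
  have h2 := (Nat.ceil_lt_add_one (zero_le_one.trans h1)).le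
  unfold window
  linarith

/-- A window ending at $t$ starts no earlier than $t/2$, so polynomial weights at its two ends are
comparable. -/
theorem eventually_two_mul_window_le {ρ : ℝ} (hρ : 0 ≤ ρ) (hρ1 : ρ < 1) :
    ∀ᶠ t in atTop, 2 * window ρ t ≤ t := by
  -- The constant $1/8$ gives $2\cdot$window $\le 4(t+1)^\rho\le (t+1)/2\le t$ once $t\ge1$.
  have h := (tendsto_add_one_rpow_neg (sub_pos.2 hρ1)).eventually_lt_const
    (show (0 : ℝ) < 1 / 8 by norm_num)
  filter_upwards [h, eventually_ge_atTop 1] with t ht ht1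
  have hpos : (0 : ℝ) < (t : ℝ) + 1 := by positivity
  have h2 := window_le hρ t
  have h3 : ((t : ℝ) + 1) ^ ρ = ((t : ℝ) + 1) ^ (-(1 - ρ)) * ((t : ℝ) + 1) := by
    conv_rhs => rw [← Real.rpow_one ((t : ℝ) + 1), ← Real.rpow_mul (by positivity), ← Real.rpow_add hpos]
    congr 1; ring
  have h4 : (1 : ℝ) ≤ t := by exact_mod_cast ht1
  have h5 : (2 * window ρ t : ℝ) ≤ t := by rw [h3] at h2; nlinarith
  exact_mod_cast h5

theorem tendsto_sub_window {ρ : ℝ} (hρ : 0 ≤ ρ) (hρ1 : ρ < 1) :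
    Tendsto (fun t => t - window ρ t) atTop atTop := by
  refine tendsto_atTop.2 fun T => ?_
  filter_upwards [eventually_two_mul_window_le hρ hρ1, eventually_ge_atTop (2 * T)] with t h1 h2
  omega

theorem decay_nonneg {c : ℝ} (hc : 0 ≤ c) (τ : ℝ) (t : ℕ) : 0 ≤ decay c τ t := by
  unfold decay; positivity

theorem decay_pos {c : ℝ} (hc : 0 < c) (τ : ℝ) (t : ℕ) : 0 < decay c τ t := by
  unfold decay; positivity

theorem decay_eq (c τ : ℝ) (t : ℕ) : decay c τ t = c * ((t : ℝ) + 1) ^ (-τ) := by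
  rw [decay, Real.rpow_neg (by positivity), div_eq_mul_inv]

theorem decay_antitone {c τ : ℝ} (hc : 0 ≤ c) (hτ : 0 ≤ τ) : Antitone (decay c τ) := by
  intro s t hst
  unfold decay
  gcongr

theorem tendsto_decay (c : ℝ) {τ : ℝ} (hτ : 0 < τ) : Tendsto (decay c τ) atTop (𝓝 0) := by
  have := (tendsto_add_one_rpow_neg hτ).const_mul c
  rw [mul_zero] at this
  exact this.congr fun t => (decay_eq c τ t).symm

theorem summable_mul_exp_neg {κ η : ℝ} (hκ : 0 < κ) (hη : 0 < η) :
    Summable fun t : ℕ => ((t : ℝ) + 1) ^ 4 * Real.exp (-κ * ((t : ℝ) + 1) ^ η) := by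
  have h1 : (fun t : ℕ => Real.exp (-κ * ((t : ℝ) + 1) ^ η))
      =O[atTop] fun t : ℕ => ((t : ℝ) + 1) ^ (-6 : ℝ) := by
    -- In the variable $(t+1)^\eta$ this is the power $(t+1)^{-6}$; against the factor $(t+1)^4$ it
    -- leaves a summable inverse square.
    have h := (isLittleO_exp_neg_mul_rpow_atTop hκ (-6 / η)).comp_tendsto
      ((tendsto_rpow_atTop hη).comp tendsto_natCast_add_one)
    refine h.isBigO.congr (fun _ => rfl) fun t => ?_
    simp only [Function.comp_apply]
    rw [← Real.rpow_mul (by positivity)]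
    congr 1; field_simp
  have h2 : (fun t : ℕ => ((t : ℝ) + 1) ^ 4 * Real.exp (-κ * ((t : ℝ) + 1) ^ η))
      =O[atTop] fun t : ℕ => (1 : ℝ) / ((t + 1 : ℕ) : ℝ) ^ (2 : ℕ) := by
    refine ((Asymptotics.isBigO_refl _ _).mul h1).congr (fun _ => rfl) fun t => ?_
    have hpos : (0 : ℝ) < (t : ℝ) + 1 := by positivity
    rw [show (-6 : ℝ) = -((6 : ℕ) : ℝ) by norm_num, Real.rpow_neg hpos.le, Real.rpow_natCast]
    push_cast
    field_simp
  refine summable_of_isBigO_nat ?_ h2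
  exact (summable_nat_add_iff 1).2 (Real.summable_one_div_nat_pow.2 (by norm_num))

end Rates

/-! ### The network forgets its past; decay of the disagreement -/

section Forgetting

variable {N : ℕ} {Ω : Type*} [m0 : MeasurableSpace Ω] {μ : Measure Ω}
  {P : Fin N → ℕ} {G : ℕ → Ω → SimpleGraph (Fin N)} {w : ∀ n : Fin N, ℕ → Ω → Fin (P n) → ℝ}

/-- Over the window the step sizes sum to at least $b(t+1)^{\rho-\tau}$, so the mean square is
stretched-exponentially small. The factor $(t+1)^2$ leaves one power for the growth of the
disagreement and one for the rate sought. -/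
theorem ae_tendsto_flow [IsProbabilityMeasure μ]
    (hG : ∀ t, Measurable fun ω => laplacianEntries (G t ω)) (hw : ∀ n t, Measurable (w n t))
    (hG_past : ∀ t, Indep
      (MeasurableSpace.comap (fun ω => laplacianEntries (G t ω)) inferInstance) (history G w t) μ)
    {J : Finset (Fin N)} {lam : ℝ} (hlam : 0 < lam)
    (hgap : ∀ t, ∀ z : Fin N → ℝ, (∀ i, i ∉ J → z i = 0) → ∑ i, z i = 0 →
      lam * ‖WithLp.toLp 2 z‖ ^ 2 ≤ energy (fun i j => ∫ ω, edgeWeight J (G t ω) i j ∂μ) z)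
    {b τ ρ : ℝ} (hb : 0 < b) (hτ : 0 < τ) (hτρ : τ < ρ) (hρ1 : ρ < 1)
    {v : Fin N → ℝ} (hv : ∀ i, i ∉ J → v i = 0) (hvs : ∑ i, v i = 0) :
    ∀ᵐ ω ∂μ, Tendsto (fun t : ℕ => ((t : ℝ) + 1) ^ 2 * ‖WithLp.toLp 2 (flow
      (fun t => edgeWeight J (G t ω)) (decay b τ) (t - window ρ t) v (window ρ t))‖)
      atTop (𝓝 0) := by
  set F : ℕ → Ω → Fin N → ℝ := fun t ω =>
    flow (fun t => edgeWeight J (G t ω)) (decay b τ) (t - window ρ t) v (window ρ t) with hF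
  have hρ0 : 0 ≤ ρ := hτ.le.trans hτρ.le
  obtain ⟨T, hT⟩ : ∃ T, ∀ t, T ≤ t → 2 * Fintype.card (Fin N) * decay b τ t ≤ 1 := by
    have h := (tendsto_decay b hτ).const_mul (2 * (Fintype.card (Fin N) : ℝ))
    rw [mul_zero] at h
    exact eventually_atTop.1 (h.eventually_le_const one_pos)
  have hFm : ∀ t, Measurable (F t) := fun t =>
    (measurable_flow (w := w) J (decay b τ) (t - window ρ t) v (window ρ t)).mono
      (history_le hG hw _) le_rfl
  have hFn : ∀ t, Measurable fun ω => ‖WithLp.toLp 2 (F t ω)‖ ^ 2 := by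
    intro t
    simp only [norm_toLp_sq]
    exact Finset.measurable_sum _ fun i _ => (measurable_pi_iff.1 (hFm t) i).pow_const 2
  -- Early times are set to zero: the contraction estimates need small step sizes throughout the
  -- window.
  set X : ℕ → Ω → ℝ := fun t ω =>
    if T ≤ t - window ρ t then ((t : ℝ) + 1) ^ 4 * ‖WithLp.toLp 2 (F t ω)‖ ^ 2 else 0 with hX
  have hXint : ∀ t, Integrable (X t) μ := by
    intro t
    by_cases h : T ≤ t - window ρ t
    · simp only [hX, h, if_true]
      refine Integrable.const_mul (Integrable.of_bound (hFn t).aestronglyMeasurable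
        (‖WithLp.toLp 2 v‖ ^ 2) (Eventually.of_forall fun ω => ?_)) _
      rw [Real.norm_of_nonneg (sq_nonneg _)]
      exact pow_le_pow_left₀ (norm_nonneg _) (norm_flow_le (fun t => edgeWeight_comm _ _)
        (fun t => edgeWeight_nonneg _ _) (fun t => edgeWeight_le_one _ _) (decay_nonneg hb.le τ)
        (fun r hr => hT r (h.trans hr)) v _) 2
    · simp [hX, h]
  have hsum := (summable_mul_exp_neg (mul_pos hlam hb) (sub_pos.2 hτρ)).mul_right
    (‖WithLp.toLp 2 v‖ ^ 2)
  have hbound : ∀ᶠ t in atTop, ∫ ω, X t ω ∂μ ≤ ((t : ℝ) + 1) ^ 4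
      * Real.exp (-(lam * b) * ((t : ℝ) + 1) ^ (ρ - τ)) * ‖WithLp.toLp 2 v‖ ^ 2 := by
    filter_upwards [(tendsto_sub_window hρ0 hρ1).eventually_ge_atTop T,
      eventually_two_mul_window_le hρ0 hρ1] with t h h'
    simp only [hX, h, if_true]
    rw [integral_const_mul, mul_assoc]
    refine mul_le_mul_of_nonneg_left ?_ (by positivity)
    refine (integral_flow_le hG hw hG_past hgap (decay_nonneg hb.le τ)
      (fun r hr => hT r (h.trans hr)) hv hvs (window ρ t)).trans ?_
    refine mul_le_mul_of_nonneg_right (Real.exp_le_exp.2 ?_) (sq_nonneg _)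
    have hpos : (0 : ℝ) < (t : ℝ) + 1 := by positivity
    have h1 : b * ((t : ℝ) + 1) ^ (ρ - τ)
        ≤ ∑ r ∈ Finset.range (window ρ t), decay b τ (t - window ρ t + r) := by
      calc b * ((t : ℝ) + 1) ^ (ρ - τ) = ((t : ℝ) + 1) ^ ρ * decay b τ t := by
            rw [decay_eq, sub_eq_add_neg, Real.rpow_add hpos]; ring
        _ ≤ window ρ t * decay b τ t :=
            mul_le_mul_of_nonneg_right (rpow_le_window ρ t) (decay_nonneg hb.le τ t)
        _ = ∑ r ∈ Finset.range (window ρ t), decay b τ t := by simp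
        _ ≤ _ := Finset.sum_le_sum fun r hr => decay_antitone hb.le hτ.le (by
            have := Finset.mem_range.1 hr; omega)
    nlinarith
  have hae := ae_tendsto_zero_of_summable_integral (μ := μ) (X := X)
    (fun t ω => by simp only [hX]; split_ifs <;> positivity) hXint hsum hbound
  filter_upwards [hae] with ω hω
  have h1 := hω.sqrt
  rw [Real.sqrt_zero] at h1
  refine h1.congr' ?_
  filter_upwards [(tendsto_sub_window hρ0 hρ1).eventually_ge_atTop T] with t h
  simp only [hX, h, if_true]
  rw [show ((t : ℝ) + 1) ^ 4 * ‖WithLp.toLp 2 (F t ω)‖ ^ 2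
    = (((t : ℝ) + 1) ^ 2 * ‖WithLp.toLp 2 (F t ω)‖) ^ 2 by ring, Real.sqrt_sq (by positivity)]

/-- A purely deterministic statement. The disagreement at the start of the window has grown at most
linearly and is wiped out by the flow; perturbations inside the window contribute at most its length
times their size, of order $(t+1)^{\rho-\sigma}$. -/
theorem tendsto_disagreement {ι : Type*} [Fintype ι] [DecidableEq ι] {J : Finset ι}
    {c : ℕ → ι → ι → ℝ} (hc : ∀ t i j, c t i j = c t j i)
    (h0 : ∀ t i j, 0 ≤ c t i j) (h1 : ∀ t i j, c t i j ≤ 1)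
    {b τ ρ σ τ' K : ℝ} (hb : 0 < b) (hτ : 0 < τ) (hτρ : τ < ρ) (hρ1 : ρ < 1) (hσ : 0 ≤ σ)
    (hτ' : τ' ≤ 1) (hσρ : ρ + τ' < σ)
    {d e : ℕ → ι → ℝ} (hd : ∀ t, d (t + 1) = averagingStep (c t) (decay b τ t) (d t) + e t)
    (hdJ : ∀ t i, i ∉ J → d t i = 0) (hds : ∀ t, ∑ i, d t i = 0)
    (he : ∀ t, ‖WithLp.toLp 2 (e t)‖ ≤ decay K σ t)
    (hflow : ∀ i, Tendsto (fun t : ℕ => ((t : ℝ) + 1) ^ 2 * ‖WithLp.toLp 2 (flow c (decay b τ)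
      (t - window ρ t) (center J (Pi.single i 1)) (window ρ t))‖) atTop (𝓝 0)) :
    Tendsto (fun t : ℕ => ((t : ℝ) + 1) ^ τ' * ‖WithLp.toLp 2 (d t)‖) atTop (𝓝 0) := by
  have hρ0 : 0 ≤ ρ := hτ.le.trans hτρ.le
  have hK : 0 ≤ K := by
    have := (norm_nonneg _).trans (he 0)
    simpa [decay] using this
  obtain ⟨T, hT⟩ : ∃ T, ∀ t, T ≤ t → 2 * Fintype.card ι * decay b τ t ≤ 1 := by
    have h := (tendsto_decay b hτ).const_mul (2 * (Fintype.card ι : ℝ))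
    rw [mul_zero] at h
    exact eventually_atTop.1 (h.eventually_le_const one_pos)
  have hβ := decay_nonneg hb.le τ
  have hgrowth : ∀ t, T ≤ t → ‖WithLp.toLp 2 (d t)‖
      ≤ (‖WithLp.toLp 2 (d T)‖ + K) * ((t : ℝ) + 1) := by
    intro t ht
    obtain ⟨k, rfl⟩ := Nat.exists_eq_add_of_le ht
    have hA := norm_sub_flow_le hc h0 h1 hβ hT hd k
    have hB := norm_flow_le hc h0 h1 hβ hT (d T) k
    have hC : ∑ r ∈ Finset.range k, ‖WithLp.toLp 2 (e (T + r))‖ ≤ k * K := by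
      calc _ ≤ ∑ r ∈ Finset.range k, K := Finset.sum_le_sum fun r _ => (he _).trans (by
            have h := decay_antitone hK hσ (Nat.zero_le (T + r))
            refine h.trans (le_of_eq ?_); simp [decay])
        _ = _ := by simp
    have hD : ‖WithLp.toLp 2 (d (T + k))‖ ≤ ‖WithLp.toLp 2 (d T)‖ + k * K := by
      have := norm_add_le (WithLp.toLp 2 (d (T + k) - flow c (decay b τ) T (d T) k))
        (WithLp.toLp 2 (flow c (decay b τ) T (d T) k))
      rw [← WithLp.toLp_add, sub_add_cancel] at this
      linarith
    refine hD.trans ?_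
    push_cast
    have := norm_nonneg (WithLp.toLp 2 (d T))
    have hk : (0 : ℝ) ≤ k := k.cast_nonneg
    have hT0 : (0 : ℝ) ≤ T := T.cast_nonneg
    nlinarith [mul_nonneg this hk, mul_nonneg this hT0, mul_nonneg hK hT0]
  set C := ‖WithLp.toLp 2 (d T)‖ + K with hC
  have hC0 : 0 ≤ C := by positivity
  have hlim : Tendsto (fun t : ℕ => C * ∑ i, ((t : ℝ) + 1) ^ 2 * ‖WithLp.toLp 2 (flow c (decay b τ)
      (t - window ρ t) (center J (Pi.single i 1)) (window ρ t))‖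
      + 2 * K * 2 ^ σ * ((t : ℝ) + 1) ^ (-(σ - (ρ + τ')))) atTop (𝓝 0) := by
    have hA := (tendsto_finsetSum (Finset.univ : Finset ι) fun i _ => hflow i).const_mul C
    have hB := (tendsto_add_one_rpow_neg (sub_pos.2 hσρ)).const_mul (2 * K * 2 ^ σ)
    simpa using hA.add hB
  refine squeeze_zero' (Eventually.of_forall fun t => by positivity) ?_ hlim
  filter_upwards [(tendsto_sub_window hρ0 hρ1).eventually_ge_atTop T,
    eventually_two_mul_window_le hρ0 hρ1] with t ht hwt
  set k := window ρ t with hk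
  set s := t - k with hs
  have hsk : s + k = t := by omega
  have hpos : (0 : ℝ) < (t : ℝ) + 1 := by positivity
  have hA := norm_sub_flow_le hc h0 h1 hβ (fun r hr => hT r (ht.trans hr)) hd k
  rw [hsk] at hA
  have hB : ‖WithLp.toLp 2 (flow c (decay b τ) s (d s) k)‖
      ≤ C * ((t : ℝ) + 1) * ∑ i, ‖WithLp.toLp 2 (flow c (decay b τ) s (center J (Pi.single i 1)) k)‖ := by
    nth_rewrite 1 [eq_sum_center_single (hdJ s) (hds s)]
    rw [flow_linear, WithLp.toLp_sum, Finset.mul_sum]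
    refine (norm_sum_le _ _).trans (Finset.sum_le_sum fun i _ => ?_)
    rw [WithLp.toLp_smul, norm_smul, Real.norm_eq_abs]
    refine mul_le_mul_of_nonneg_right ?_ (norm_nonneg _)
    refine (abs_le_norm_toLp _ i).trans ((hgrowth s ht).trans ?_)
    refine mul_le_mul_of_nonneg_left ?_ hC0
    have : (s : ℝ) ≤ t := by exact_mod_cast (by omega : s ≤ t)
    linarith
  have hD : ∑ r ∈ Finset.range k, ‖WithLp.toLp 2 (e (s + r))‖
      ≤ 2 * ((t : ℝ) + 1) ^ ρ * (K * 2 ^ σ * ((t : ℝ) + 1) ^ (-σ)) := by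
    have hsr : ∀ r, ‖WithLp.toLp 2 (e (s + r))‖ ≤ K * 2 ^ σ * ((t : ℝ) + 1) ^ (-σ) := by
      intro r
      refine (he _).trans ((decay_antitone hK hσ (Nat.le_add_right s r)).trans ?_)
      rw [decay_eq, mul_assoc]
      refine mul_le_mul_of_nonneg_left ?_ hK
      have hst : ((t : ℝ) + 1) / 2 ≤ (s : ℝ) + 1 := by
        have : (t : ℝ) ≤ 2 * s := by exact_mod_cast (by omega : t ≤ 2 * s)
        linarith
      calc ((s : ℝ) + 1) ^ (-σ) ≤ (((t : ℝ) + 1) / 2) ^ (-σ) :=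
            Real.rpow_le_rpow_of_nonpos (by positivity) hst (by linarith)
        _ = 2 ^ σ * ((t : ℝ) + 1) ^ (-σ) := by
            rw [Real.div_rpow hpos.le (by norm_num), Real.rpow_neg (by norm_num : (0 : ℝ) ≤ 2)]
            field_simp
    calc _ ≤ ∑ _r ∈ Finset.range k, K * 2 ^ σ * ((t : ℝ) + 1) ^ (-σ) :=
          Finset.sum_le_sum fun r _ => hsr r
      _ = k * (K * 2 ^ σ * ((t : ℝ) + 1) ^ (-σ)) := by simp
      _ ≤ _ := mul_le_mul_of_nonneg_right (window_le hρ0 t) (by positivity)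
  have hE : ‖WithLp.toLp 2 (d t)‖ ≤ ‖WithLp.toLp 2 (flow c (decay b τ) s (d s) k)‖
      + ∑ r ∈ Finset.range k, ‖WithLp.toLp 2 (e (s + r))‖ := by
    have := norm_add_le (WithLp.toLp 2 (d t - flow c (decay b τ) s (d s) k))
      (WithLp.toLp 2 (flow c (decay b τ) s (d s) k))
    rw [← WithLp.toLp_add, sub_add_cancel] at this
    linarith
  have hp1 : ((t : ℝ) + 1) ^ τ' ≤ (t : ℝ) + 1 := by
    calc _ ≤ ((t : ℝ) + 1) ^ (1 : ℝ) :=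
          Real.rpow_le_rpow_of_exponent_le (by linarith [t.cast_nonneg (α := ℝ)]) hτ'
      _ = _ := Real.rpow_one _
  have hp2 : ((t : ℝ) + 1) ^ (-(σ - (ρ + τ')))
      = ((t : ℝ) + 1) ^ τ' * (((t : ℝ) + 1) ^ ρ * ((t : ℝ) + 1) ^ (-σ)) := by
    rw [← Real.rpow_add hpos, ← Real.rpow_add hpos]; congr 1; ring
  set Φ := ∑ i, ‖WithLp.toLp 2 (flow c (decay b τ) s (center J (Pi.single i 1)) k)‖ with hΦ
  have hΦ0 : 0 ≤ Φ := Finset.sum_nonneg fun i _ => norm_nonneg _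
  rw [← Finset.mul_sum, ← hΦ, hp2]
  calc ((t : ℝ) + 1) ^ τ' * ‖WithLp.toLp 2 (d t)‖
      ≤ ((t : ℝ) + 1) ^ τ' * (C * ((t : ℝ) + 1) * Φ
        + 2 * ((t : ℝ) + 1) ^ ρ * (K * 2 ^ σ * ((t : ℝ) + 1) ^ (-σ))) :=
        mul_le_mul_of_nonneg_left (by linarith) (by positivity)
    _ = ((t : ℝ) + 1) ^ τ' * (C * ((t : ℝ) + 1) * Φ) + 2 * K * 2 ^ σ
        * (((t : ℝ) + 1) ^ τ' * (((t : ℝ) + 1) ^ ρ * ((t : ℝ) + 1) ^ (-σ))) := by ring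
    _ ≤ ((t : ℝ) + 1) * (C * ((t : ℝ) + 1) * Φ) + 2 * K * 2 ^ σ
        * (((t : ℝ) + 1) ^ τ' * (((t : ℝ) + 1) ^ ρ * ((t : ℝ) + 1) ^ (-σ))) :=
        add_le_add_left (mul_le_mul_of_nonneg_right hp1 (by positivity)) _
    _ = _ := by ring

end Forgetting

/-! ### Strong law with a rate for the noise averages -/

section Noise

/-- Kronecker's lemma. -/
theorem tendsto_sum_div_of_tendsto_sum_div {b x : ℕ → ℝ} {A : ℝ} (hb : ∀ n, 0 < b n)
    (hmono : Monotone b) (htop : Tendsto b atTop atTop)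
    (hA : Tendsto (fun n => ∑ s ∈ Finset.range n, x s / b s) atTop (𝓝 A)) :
    Tendsto (fun n => (∑ s ∈ Finset.range n, x s) / b n) atTop (𝓝 0) := by
  set S : ℕ → ℝ := fun n => ∑ s ∈ Finset.range n, x s / b s with hS
  -- Abel summation with the partial sums recentered at their limit, so that the remainder is $o$ of
  -- a telescoping sum of increments of $b$.
  have hparts : ∀ n, ∑ s ∈ Finset.range n, x s = b n * (S n - A)
      - ∑ s ∈ Finset.range n, (b (s + 1) - b s) * (S (s + 1) - A) + b 0 * A := by
    intro n
    induction n with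
    | zero => simp [hS]
    | succ n ih =>
      rw [Finset.sum_range_succ, ih, Finset.sum_range_succ]
      have : S (n + 1) = S n + x n / b n := Finset.sum_range_succ _ _
      have hx : x n = b n * (S (n + 1) - S n) := by
        rw [this]; field_simp [(hb n).ne']; ring
      rw [hx]; ring
  have hdiff : Tendsto (fun n => S n - A) atTop (𝓝 0) := by
    simpa using hA.sub_const A
  have hlit : (fun s => (b (s + 1) - b s) * (S (s + 1) - A)) =o[atTop]
      fun s => b (s + 1) - b s := by
    have h1 : (fun s => S (s + 1) - A) =o[atTop] fun _ => (1 : ℝ) :=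
      (Asymptotics.isLittleO_one_iff ℝ).2 ((tendsto_add_atTop_iff_nat 1).2 hdiff)
    simpa using (Asymptotics.isBigO_refl (fun s => b (s + 1) - b s) atTop).mul_isLittleO h1
  have htel : ∀ n, ∑ s ∈ Finset.range n, (b (s + 1) - b s) = b n - b 0 :=
    fun n => Finset.sum_range_sub b n
  have hsum := hlit.sum_range (fun s => sub_nonneg.2 (hmono s.le_succ)) (by
    simp only [htel]; exact tendsto_atTop_add_const_right _ _ htop)
  simp only [htel] at hsum
  have hO : (fun n => b n - b 0) =O[atTop] b := by
    refine Asymptotics.IsBigO.of_bound 1 (Eventually.of_forall fun n => ?_)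
    rw [Real.norm_of_nonneg (sub_nonneg.2 (hmono n.zero_le)), Real.norm_of_nonneg (hb n).le, one_mul]
    linarith [hb 0]
  have h2 := (hsum.trans_isBigO hO).tendsto_div_nhds_zero
  have h3 : Tendsto (fun n => b 0 * A / b n) atTop (𝓝 0) := htop.const_div_atTop _
  have := (hdiff.sub h2).add h3
  simp only [sub_zero, add_zero] at this
  refine this.congr fun n => ?_
  rw [hparts n]
  field_simp [(hb n).ne']

variable {Ω : Type*} [m0 : MeasurableSpace Ω] {μ : Measure Ω}

/-- The sums of $X_s/(s+1)^{1-\tau}$ form a martingale, bounded in $L^2$ because $2(1-\tau)>1$; it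
converges almost surely, and Kronecker's lemma turns convergence into the rate. -/
theorem ae_tendsto_weighted_average [IsProbabilityMeasure μ] (ℱ : Filtration ℕ m0) {X : ℕ → Ω → ℝ}
    (hXm : ∀ t, Measurable[ℱ (t + 1)] (X t))
    (hind : ∀ t, Indep (MeasurableSpace.comap (X t) inferInstance) (ℱ t) μ)
    (hL2 : ∀ t, MemLp (X t) 2 μ) (hmean : ∀ t, ∫ ω, X t ω ∂μ = 0) {V : ℝ}
    (hV : ∀ t, ∫ ω, X t ω ^ 2 ∂μ ≤ V) {τ : ℝ} (hτ : τ < 1 / 2) :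
    ∀ᵐ ω ∂μ, Tendsto (fun t : ℕ => ((t : ℝ) + 1) ^ τ
      * ((∑ s ∈ Finset.range (t + 1), X s ω) / ((t : ℝ) + 1))) atTop (𝓝 0) := by
  set b : ℕ → ℝ := fun s => ((s : ℝ) + 1) ^ (1 - τ) with hb
  have hbpos : ∀ s, 0 < b s := fun s => by simp only [hb]; positivity
  set S : ℕ → Ω → ℝ := fun t ω => ∑ s ∈ Finset.range t, X s ω / b s with hS
  have hXm0 : ∀ t, Measurable (X t) := fun t => (hXm t).mono (ℱ.le _) le_rfl
  have hSm : ∀ t, Measurable[ℱ t] (S t) := by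
    intro t
    refine Finset.measurable_sum _ fun s hs => ?_
    exact ((hXm s).mono (ℱ.mono (Finset.mem_range.1 hs)) le_rfl).div_const _
  have hSL2 : ∀ t, MemLp (S t) 2 μ := by
    intro t
    refine memLp_finsetSum _ fun s _ => ?_
    simp only [div_eq_mul_inv]
    exact (hL2 s).mul_const _
  have hSint : ∀ t, Integrable (S t) μ := fun t => (hSL2 t).integrable one_le_two
  have hXint : ∀ t, Integrable (X t) μ := fun t => (hL2 t).integrable one_le_two
  have hsucc : ∀ t ω, S (t + 1) ω = S t ω + X t ω / b t := fun t ω => Finset.sum_range_succ _ _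
  have hmart : Martingale S ℱ μ := by
    refine martingale_of_condExp_sub_eq_zero_nat (fun t => (hSm t).stronglyMeasurable) hSint
      fun t => ?_
    have h1 : S (t + 1) - S t = fun ω => X t ω / b t := by
      ext ω; simp [hsucc]
    rw [h1]
    have h2 := condExp_indep_eq (μ := μ) (f := fun ω => X t ω / b t) ((hXm0 t).comap_le) (ℱ.le t)
      (((comap_measurable (X t)).div_const _).stronglyMeasurable) (hind t)
    refine h2.trans (Eventually.of_forall fun ω => ?_)
    simp [integral_div, hmean t]
  have hsq : ∀ t, ∫ ω, S t ω ^ 2 ∂μ ≤ V * ∑ s ∈ Finset.range t, 1 / b s ^ 2 := by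
    intro t
    induction t with
    | zero => simp [hS]
    | succ t ih =>
      have hprod : IndepFun (X t) (S t) μ := by
        rw [IndepFun_iff_Indep]
        exact indep_of_indep_of_le_right (hind t) (hSm t).comap_le
      have hpi : Integrable (fun ω => X t ω * S t ω) μ := hprod.integrable_mul (hXint t) (hSint t)
      have hp0 : ∫ ω, X t ω * S t ω ∂μ = 0 := by
        rw [hprod.integral_fun_mul_eq_mul_integral (hXint t).aestronglyMeasurable
          (hSint t).aestronglyMeasurable, hmean, zero_mul]
      have hexp : ∀ ω, S (t + 1) ω ^ 2
          = S t ω ^ 2 + (2 / b t * (X t ω * S t ω) + 1 / b t ^ 2 * X t ω ^ 2) := by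
        intro ω; rw [hsucc]; ring
      have hrest : Integrable (fun ω => 2 / b t * (X t ω * S t ω) + 1 / b t ^ 2 * X t ω ^ 2) μ :=
        (hpi.const_mul _).add ((hL2 t).integrable_sq.const_mul _)
      simp only [hexp]
      rw [integral_add (hSL2 t).integrable_sq hrest,
        integral_add (hpi.const_mul _) ((hL2 t).integrable_sq.const_mul _), integral_const_mul,
        integral_const_mul, hp0, mul_zero, zero_add, Finset.sum_range_succ, mul_add]
      refine add_le_add ih ?_
      rw [mul_comm V]
      exact mul_le_mul_of_nonneg_left (hV t) (by positivity)
  have hsummable : Summable fun s => 1 / b s ^ 2 := by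
    have h := (summable_nat_add_iff 1).2 (Real.summable_one_div_nat_rpow (p := 2 * (1 - τ)).2
      (by linarith))
    refine h.congr fun s => ?_
    simp only [hb]
    push_cast
    rw [← Real.rpow_natCast, ← Real.rpow_mul (by positivity)]
    congr 2; push_cast; ring
  have hV0 : 0 ≤ V := (integral_nonneg fun ω => sq_nonneg _).trans (hV 0)
  have hbdd : ∀ t, eLpNorm (S t) 1 μ ≤ (Real.toNNReal (1 + V * ∑' s, 1 / b s ^ 2) : ENNReal) := by
    intro t
    rw [eLpNorm_one_eq_lintegral_enorm, ← ofReal_integral_norm_eq_lintegral_enorm (hSint t)]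
    refine ENNReal.ofReal_le_ofReal ?_
    -- The convergence theorem asks for an $L^1$ bound, obtained from $|x|\le 1+x^2$.
    have h1 : ∫ ω, ‖S t ω‖ ∂μ ≤ ∫ ω, (1 + S t ω ^ 2) ∂μ := by
      refine integral_mono (hSint t).norm ((integrable_const 1).add (hSL2 t).integrable_sq) fun ω => ?_
      simp only [Real.norm_eq_abs]
      nlinarith [sq_abs (S t ω), sq_nonneg (|S t ω| - 1)]
    rw [integral_add (integrable_const 1) (hSL2 t).integrable_sq] at h1
    simp only [integral_const, probReal_univ, smul_eq_mul, mul_one] at h1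
    refine h1.trans (add_le_add_right ((hsq t).trans (mul_le_mul_of_nonneg_left ?_ hV0)) _)
    exact hsummable.sum_le_tsum _ fun s _ => by positivity
  have hτ1 : 0 < 1 - τ := by linarith
  have hmono : Monotone b := by
    intro s t hst
    simp only [hb]
    exact Real.rpow_le_rpow (by positivity) (by gcongr) hτ1.le
  have htop : Tendsto b atTop atTop := (tendsto_rpow_atTop hτ1).comp tendsto_natCast_add_one
  filter_upwards [hmart.submartingale.exists_ae_tendsto_of_bdd hbdd] with ω ⟨A, hA⟩
  have h1 := tendsto_sum_div_of_tendsto_sum_div (x := fun s => X s ω) hbpos hmono htop hA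
  -- Kronecker's lemma covers the indices $s<t$; the term $s=t$ is an increment of a convergent
  -- series.
  have h2 : Tendsto (fun t => X t ω / b t) atTop (𝓝 0) := by
    have := ((tendsto_add_atTop_iff_nat 1).2 hA).sub hA
    rw [sub_self] at this
    exact this.congr fun t => by simp only [hsucc]; ring
  have h3 := h1.add h2
  rw [add_zero] at h3
  refine h3.congr fun t => ?_
  have hpos : (0 : ℝ) < (t : ℝ) + 1 := by positivity
  rw [Finset.sum_range_succ, ← add_div]
  simp only [hb]
  rw [Real.rpow_sub hpos, Real.rpow_one]
  field_simp

theorem timeAverage_eq {k : ℕ} (y : ℕ → Fin k → ℝ) (t : ℕ) (i : Fin k) :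
    timeAverage y t i = (∑ s ∈ Finset.range (t + 1), y s i) / ((t : ℝ) + 1) := by
  induction t with
  | zero => simp [timeAverage]
  | succ t ih =>
    rw [Finset.sum_range_succ]
    simp only [timeAverage, Pi.add_apply, Pi.smul_apply, smul_eq_mul, ih]
    push_cast
    field_simp
    ring

theorem ae_tendsto_noise_average [IsProbabilityMeasure μ] {N : ℕ} {P : Fin N → ℕ}
    {G : ℕ → Ω → SimpleGraph (Fin N)} {w : ∀ n : Fin N, ℕ → Ω → Fin (P n) → ℝ}
    (hG : ∀ t, Measurable fun ω => laplacianEntries (G t ω)) (hw : ∀ n t, Measurable (w n t))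
    (hw_L2 : ∀ n t i, MemLp (fun ω => w n t ω i) 2 μ)
    (hw_mean : ∀ n t i, ∫ ω, w n t ω i ∂μ = 0) (hw_ident : ∀ n t, IdentDistrib (w n t) (w n 0) μ μ)
    (hw_past : ∀ t, Indep (⨆ n, MeasurableSpace.comap (w n t) inferInstance) (history G w t) μ)
    {τ : ℝ} (hτ : τ < 1 / 2) (n : Fin N) (i : Fin (P n)) :
    ∀ᵐ ω ∂μ, Tendsto (fun t : ℕ => ((t : ℝ) + 1) ^ τ * timeAverage (fun t => w n t ω) t i)
      atTop (𝓝 0) := by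
  let ℱ : Filtration ℕ m0 := ⟨history G w, history_mono, history_le hG hw⟩
  simp only [timeAverage_eq]
  refine ae_tendsto_weighted_average ℱ (X := fun t ω => w n t ω i) (fun t => ?_) (fun t => ?_)
    (fun t => hw_L2 n t i) (fun t => hw_mean n t i) (V := ∫ ω, w n 0 ω i ^ 2 ∂μ) (fun t => ?_) hτ
  · exact (measurable_pi_apply i).comp (measurable_history_noise (G := G) (by omega : t < t + 1) n)
  · refine indep_of_indep_of_le_left (hw_past t) (le_trans ?_ (le_iSup _ n))
    exact Measurable.comap_le ((measurable_pi_apply i).comp (comap_measurable (w n t)))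
  · have h := (hw_ident n t).comp (u := fun x : Fin (P n) → ℝ => x i ^ 2)
      ((measurable_pi_apply i).pow_const 2)
    exact h.integral_eq.le

end Noise

/-! ### A scalar recursion with drift towards a shrinking threshold -/

section Drift

/-- For $x\le1$ and $\tau\le1$ one has $x\le x^\tau$, so the relative decrease is at most $1/(t+1)$,
slower than the drift $\alpha_t$. -/
theorem decay_sub_succ_le {c τ : ℝ} (hc : 0 ≤ c) (hτ : τ ≤ 1) (t : ℕ) :
    decay c τ t - decay c τ (t + 1) ≤ decay c τ t / ((t : ℝ) + 1) := by
  have hpos : (0 : ℝ) < (t : ℝ) + 1 := by positivity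
  have hpos2 : (0 : ℝ) < (t : ℝ) + 2 := by positivity
  have h1 : ((t : ℝ) + 1) / (t + 2) ≤ (((t : ℝ) + 1) / (t + 2)) ^ τ := by
    refine Real.self_le_rpow_of_le_one (by positivity) ?_ hτ
    rw [div_le_one hpos2]; linarith
  have h2 : decay c τ (t + 1) = decay c τ t * (((t : ℝ) + 1) / (t + 2)) ^ τ := by
    rw [Real.div_rpow hpos.le hpos2.le]
    simp only [decay]
    push_cast
    rw [show (t : ℝ) + 1 + 1 = t + 2 by ring]
    field_simp
  have h3 : 1 - ((t : ℝ) + 1) / (t + 2) ≤ 1 / ((t : ℝ) + 1) := by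
    have : 1 - ((t : ℝ) + 1) / (t + 2) = 1 / (t + 2) := by field_simp; ring
    rw [this]
    exact one_div_le_one_div_of_le hpos (by linarith)
  rw [h2, div_eq_mul_one_div (decay c τ t)]
  have := decay_nonneg hc τ t
  nlinarith

/-- The losses $c\,\alpha_t\gamma_t$ have divergent sum, so $u$ must come below $2K\gamma_t$. It
then stays there, because $\gamma_t$ loses only $O(\gamma_t/t)$ per step while $u$, when above
$K\gamma_t$, loses more. -/
theorem exists_le_mul_decay_of_drift {u : ℕ → ℝ} (hu : ∀ t, 0 ≤ u t) {a Γ τ₁ τ c C K : ℝ}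
    (ha : 0 < a) (hΓ : 0 < Γ) (hτ₁ : 0 < τ₁) (hτ : 0 < τ) (hsum : τ₁ + τ < 1) (hc : 0 < c)
    (hK : 0 < K) (hup : ∀ t, u (t + 1) ≤ u t + C * (decay a τ₁ t * decay Γ τ t))
    (hdrift : ∀ᶠ t in atTop, K * decay Γ τ t ≤ u t →
      u (t + 1) ≤ u t - c * (decay a τ₁ t * decay Γ τ t)) :
    ∃ B, ∀ᶠ t in atTop, u t ≤ B * decay Γ τ t := by
  have hτ1' : τ ≤ 1 := by linarith
  have hτ₁' : 0 < 1 - τ₁ := by linarith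
  have e1 : ∀ᶠ t in atTop, C * decay a τ₁ t ≤ K / 2 := by
    have h := (tendsto_decay a hτ₁).const_mul C
    rw [mul_zero] at h
    exact h.eventually_le_const (by positivity)
  have e2 : ∀ᶠ t : ℕ in atTop, 2 * K / ((t : ℝ) + 1) ≤ c * decay a τ₁ t := by
    have h := (tendsto_rpow_atTop hτ₁').comp tendsto_natCast_add_one
    filter_upwards [h.eventually_ge_atTop (2 * K / (c * a))] with t ht
    have hpos : (0 : ℝ) < (t : ℝ) + 1 := by positivity
    simp only [Function.comp_apply] at ht
    rw [sub_eq_add_neg, Real.rpow_add hpos, Real.rpow_one, div_le_iff₀ (by positivity)] at ht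
    rw [decay_eq, div_le_iff₀ hpos]
    linarith
  obtain ⟨T, hT⟩ := eventually_atTop.1 (e1.and (e2.and (hdrift.and (eventually_ge_atTop 3))))
  have hstart : ∃ t₀, T ≤ t₀ ∧ u t₀ ≤ 2 * K * decay Γ τ t₀ := by
    by_contra! hcon
    have hdec : ∀ k, u (T + k) ≤ u T - c * (k * (decay a τ₁ (T + k) * decay Γ τ (T + k))) := by
      -- The loss is frozen at its smallest value, that of the last time `T + n`, which makes the
      -- induction linear in $k$.
      have h' : ∀ n k, k ≤ n →
          u (T + k) ≤ u T - c * (k * (decay a τ₁ (T + n) * decay Γ τ (T + n))) := by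
        intro n k
        induction k with
        | zero => intro _; simp
        | succ k ih =>
          intro hk
          have h1 := ih (by omega)
          have h2 := (hT (T + k) (by omega)).2.2.1 (by
            have := hcon (T + k) (by omega)
            have := decay_pos hΓ τ (T + k)
            nlinarith)
          have h3 : decay a τ₁ (T + n) * decay Γ τ (T + n)
              ≤ decay a τ₁ (T + k) * decay Γ τ (T + k) :=
            mul_le_mul (decay_antitone ha.le hτ₁.le (by omega))
              (decay_antitone hΓ.le hτ.le (by omega)) (decay_nonneg hΓ.le _ _)
              (decay_nonneg ha.le _ _)
          rw [← add_assoc]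
          push_cast
          nlinarith [mul_le_mul_of_nonneg_left h3 hc.le]
      exact fun k => h' k k le_rfl
    have h := (tendsto_rpow_atTop (sub_pos.2 hsum)).comp tendsto_natCast_add_one
    obtain ⟨t, ht1, ht2⟩ := ((h.eventually_gt_atTop (2 * u T / (c * (a * Γ)))).and
      (eventually_ge_atTop (2 * T + 1))).exists
    have h1 := hdec (t - T)
    rw [show T + (t - T) = t by omega] at h1
    have hpos : (0 : ℝ) < (t : ℝ) + 1 := by positivity
    simp only [Function.comp_apply] at ht1
    rw [div_lt_iff₀ (by positivity)] at ht1
    have h2 : ((t : ℝ) + 1) * (decay a τ₁ t * decay Γ τ t)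
        = ((t : ℝ) + 1) ^ (1 - (τ₁ + τ)) * (a * Γ) := by
      rw [decay_eq, decay_eq, show 1 - (τ₁ + τ) = 1 + (-τ₁ + -τ) by ring, Real.rpow_add hpos,
        Real.rpow_add hpos, Real.rpow_one]
      ring
    have h3 : ((t : ℝ) + 1) / 2 ≤ ((t - T : ℕ) : ℝ) := by
      rw [Nat.cast_sub (by omega)]
      have : (2 * T + 1 : ℝ) ≤ t := by exact_mod_cast ht2
      linarith
    have h4 := mul_pos (decay_pos ha τ₁ t) (decay_pos hΓ τ t)
    have h5 := mul_le_mul_of_nonneg_right h3 h4.le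
    have h6 := hu t
    have h7 := mul_le_mul_of_nonneg_left h5 hc.le
    nlinarith
  obtain ⟨t₀, ht₀, hut₀⟩ := hstart
  refine ⟨2 * K, eventually_atTop.2 ⟨t₀, fun t ht => ?_⟩⟩
  induction t, ht using Nat.le_induction with
  | base => exact hut₀
  | succ t ht ih =>
    obtain ⟨h1, h2, h3, h4⟩ := hT t (ht₀.trans ht)
    have hγ := decay_pos hΓ τ t
    have hsub := decay_sub_succ_le hΓ.le hτ1' t
    have hpos : (0 : ℝ) < (t : ℝ) + 1 := by positivity
    rcases le_total (K * decay Γ τ t) (u t) with h | h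
    · have h5 := h3 h
      have h6 : 2 * K * (decay Γ τ t - decay Γ τ (t + 1))
          ≤ c * (decay a τ₁ t * decay Γ τ t) := by
        calc _ ≤ 2 * K * (decay Γ τ t / ((t : ℝ) + 1)) :=
              mul_le_mul_of_nonneg_left hsub (by positivity)
          _ = 2 * K / ((t : ℝ) + 1) * decay Γ τ t := by ring
          _ ≤ c * decay a τ₁ t * decay Γ τ t := mul_le_mul_of_nonneg_right h2 hγ.le
          _ = _ := by ring
      linarith
    -- Here one step reaches at most $\tfrac32K\gamma_t$, and $t\ge3$ gives
    -- $\gamma_{t+1}\ge\tfrac34\gamma_t$, so $2K\gamma_{t+1}$ still dominates.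
    · have h5 := hup t
      have h6 := mul_le_mul_of_nonneg_right h1 hγ.le
      have h7 : decay Γ τ t / ((t : ℝ) + 1) ≤ decay Γ τ t / 4 := by
        refine div_le_div_of_nonneg_left hγ.le (by norm_num) ?_
        have : (3 : ℝ) ≤ t := by exact_mod_cast h4
        linarith
      nlinarith

end Drift

/-! ### Clipped innovations -/

section Clipping

theorem abs_gain_mul_le {γ : ℝ} (hγ : 0 ≤ γ) (r : ℝ) : |gain γ r * r| ≤ γ := by
  unfold gain
  split_ifs with h
  · simpa [h] using hγ
  · have hr : 0 < |r| := abs_pos.2 h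
    have h0 : 0 ≤ min 1 (γ * |r|⁻¹) := le_min zero_le_one (by positivity)
    rw [abs_mul, abs_of_nonneg h0]
    calc min 1 (γ * |r|⁻¹) * |r| ≤ γ * |r|⁻¹ * |r| :=
          mul_le_mul_of_nonneg_right (min_le_right _ _) hr.le
      _ = γ := by field_simp

/-- The gain amounts to projection onto $[-\gamma,\gamma]$; this form makes the Lipschitz bound
evident. -/
theorem gain_mul_eq {γ : ℝ} (hγ : 0 ≤ γ) (r : ℝ) : gain γ r * r = max (-γ) (min γ r) := by
  unfold gain
  split_ifs with h
  · subst h; simp [hγ]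
  · rcases lt_or_gt_of_ne h with h | h
    · rw [abs_of_neg h, min_eq_right (by linarith : r ≤ γ)]
      rcases le_total γ (-r) with h' | h'
      · rw [min_eq_right (by rw [← div_eq_mul_inv, div_le_one (by linarith)]; exact h'),
          max_eq_left (by linarith)]
        field_simp
      · rw [min_eq_left (by rw [← div_eq_mul_inv, le_div_iff₀ (by linarith)]; linarith),
          max_eq_right (by linarith), one_mul]
    · rw [abs_of_pos h]
      rcases le_total γ r with h' | h'
      · rw [min_eq_right (by rw [← div_eq_mul_inv, div_le_one h]; exact h'),
          min_eq_left h', max_eq_right (by linarith)]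
        field_simp
      · rw [min_eq_left (by rw [← div_eq_mul_inv, le_div_iff₀ h]; linarith),
          min_eq_right h', max_eq_right (by linarith), one_mul]

theorem abs_gain_mul_sub_le {γ : ℝ} (hγ : 0 ≤ γ) (r s : ℝ) :
    |gain γ r * r - gain γ s * s| ≤ |r - s| := by
  rw [gain_mul_eq hγ, gain_mul_eq hγ, max_comm (-γ), max_comm (-γ), min_comm γ, min_comm γ]
  exact (abs_max_sub_max_le_abs _ _ _).trans (by
    have := abs_min_sub_min_le_max r γ s γ
    simpa using this)

/-- Clipping at level `γ` retains the fraction `γ / B` of any number of modulus at most `B ≥ γ`. -/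
theorem mul_gain_mul_neg_le {γ B s : ℝ} (hγ : 0 < γ) (hB : γ ≤ B) (hs : |s| ≤ B) :
    s * (gain γ (-s) * (-s)) ≤ -(γ / B * s ^ 2) := by
  have hB0 : 0 < B := hγ.trans_le hB
  rcases eq_or_ne s 0 with rfl | h
  · simp
  have hs0 : 0 < |s| := abs_pos.2 h
  have h1 : γ / B ≤ gain γ (-s) := by
    rw [gain, if_neg (neg_ne_zero.2 h), abs_neg]
    refine le_min ((div_le_one hB0).2 hB) ?_
    rw [div_eq_mul_inv]
    exact mul_le_mul_of_nonneg_left (inv_anti₀ hs0 hs) hγ.le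
  nlinarith [mul_le_mul_of_nonneg_right h1 (sq_nonneg s)]

end Clipping

/-! ### Honest streams against compromised streams -/

section Resilience

variable {N M : ℕ} {P : Fin N → ℕ} (H : ∀ n, Matrix (Fin (P n)) (Fin M) ℝ)

theorem norm_transpose_mulVec_le_attackStrength (A : Finset (Stream P)) {v : A → ℝ}
    (hv : ‖v‖ ≤ 1) :
    ‖WithLp.toLp 2 ((stackedRows H A).transpose.mulVec v)‖ ≤ attackStrength H A := by
  refine le_csSup ?_ ⟨v, hv, rfl⟩
  have hset : {v : A → ℝ | ‖v‖ ≤ 1} = Metric.closedBall 0 1 := by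
    ext v; simp
  rw [hset]
  refine ((isCompact_closedBall _ _).image ?_).bddAbove
  refine continuous_norm.comp ((PiLp.continuous_toLp 2 _).comp ?_)
  exact Continuous.matrix_mulVec continuous_const continuous_id

/-- Divided by $\gamma$, the clipped values form an admissible $v$ in the definition of $\Delta_A$;
Cauchy–Schwarz does the rest. -/
theorem sum_mul_le_attackStrength (A : Finset (Stream P)) {φ : Stream P → ℝ} {γ : ℝ} (hγ : 0 < γ)
    (hφ : ∀ p, |φ p| ≤ γ) (e : Fin M → ℝ) :
    ∑ p ∈ A, (measVec H p ⬝ᵥ e) * φ p ≤ ‖WithLp.toLp 2 e‖ * (γ * attackStrength H A) := by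
  set v : A → ℝ := fun p => γ⁻¹ * φ p with hv
  have hv1 : ‖v‖ ≤ 1 := by
    refine (pi_norm_le_iff_of_nonneg zero_le_one).2 fun p => ?_
    rw [hv, Real.norm_eq_abs, abs_mul, abs_of_pos (inv_pos.2 hγ), inv_mul_le_iff₀ hγ, mul_one]
    exact hφ p
  have h1 := norm_transpose_mulVec_le_attackStrength H A hv1
  have h2 : ∑ p ∈ A, (measVec H p ⬝ᵥ e) * φ p
      = γ * inner ℝ (WithLp.toLp 2 e) (WithLp.toLp 2 ((stackedRows H A).transpose.mulVec v)) := by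
    rw [EuclideanSpace.inner_eq_star_dotProduct, star_trivial, ← Finset.sum_coe_sort A,
      Matrix.mulVec_transpose, ← Matrix.dotProduct_mulVec, dotProduct, Finset.mul_sum]
    refine Finset.sum_congr rfl fun p _ => ?_
    simp only [hv, Matrix.mulVec, stackedRows]
    change _ = γ * (γ⁻¹ * φ p * (measVec H p ⬝ᵥ e))
    field_simp
  rw [h2]
  calc _ ≤ γ * (‖WithLp.toLp 2 e‖ * attackStrength H A) :=
        mul_le_mul_of_nonneg_left ((real_inner_le_norm _ _).trans
          (mul_le_mul_of_nonneg_left h1 (norm_nonneg _))) hγ.le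
    _ = _ := by ring

theorem lambdaMin_gramian_mul_le (X : Finset (Stream P)) (e : Fin M → ℝ) :
    lambdaMin (gramian_isHermitian H X) * ‖WithLp.toLp 2 e‖ ^ 2
      ≤ ∑ p ∈ X, (measVec H p ⬝ᵥ e) ^ 2 := by
  rw [norm_toLp_sq]
  refine (lambdaMin_mul_le (gramian_isHermitian H X) e).trans (le_of_eq ?_)
  rw [gramian, Matrix.sum_mulVec, dotProduct_sum]
  refine Finset.sum_congr rfl fun p _ => ?_
  rw [Matrix.vecMulVec_mulVec, sq]
  simp [dotProduct_comm e]

theorem abs_measVec_dotProduct_le (hH : ∀ p : Stream P, ‖WithLp.toLp 2 (measVec H p)‖ = 1)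
    (p : Stream P) (e : Fin M → ℝ) : |measVec H p ⬝ᵥ e| ≤ ‖WithLp.toLp 2 e‖ := by
  have h := abs_real_inner_le_norm (WithLp.toLp 2 e) (WithLp.toLp 2 (measVec H p))
  rw [hH, mul_one, EuclideanSpace.inner_eq_star_dotProduct, star_trivial] at h
  exact h

theorem abs_measVec_le (hH : ∀ p : Stream P, ‖WithLp.toLp 2 (measVec H p)‖ = 1)
    (p : Stream P) (m : Fin M) : |measVec H p m| ≤ 1 :=
  (abs_le_norm_toLp _ m).trans (hH p).le

/-- Far from the field, the clipped innovations point towards it. -/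
theorem sum_measVec_mul_le (hH : ∀ p : Stream P, ‖WithLp.toLp 2 (measVec H p)‖ = 1)
    (A : Finset (Stream P)) {r : Stream P → ℝ} {γ η : ℝ} (hγ : 0 < γ) {e : Fin M → ℝ}
    (he : γ ≤ ‖WithLp.toLp 2 e‖) (hr : ∀ p, p ∉ A → |r p + measVec H p ⬝ᵥ e| ≤ η) :
    ∑ p, (measVec H p ⬝ᵥ e) * (gain γ (r p) * r p) ≤ ‖WithLp.toLp 2 e‖
      * (γ * attackStrength H A - γ * lambdaMin (gramian_isHermitian H Aᶜ)
        + Fintype.card (Stream P) * |η|) := by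
  have he0 : 0 < ‖WithLp.toLp 2 e‖ := hγ.trans_le he
  have h1 := sum_mul_le_attackStrength H A hγ (fun p => abs_gain_mul_le hγ.le (r p)) e
  -- An honest innovation is $-h_p^\top e$ up to $\eta$, and clipping is 1-Lipschitz. As $h_p$ is a
  -- unit vector, $|h_p^\top e|\le\|e\|$, so $\|e\|$ can serve as the bound in
  -- `mul_gain_mul_neg_le`.
  have hterm : ∀ p ∈ Aᶜ, (measVec H p ⬝ᵥ e) * (gain γ (r p) * r p)
      ≤ -(γ / ‖WithLp.toLp 2 e‖ * (measVec H p ⬝ᵥ e) ^ 2) + ‖WithLp.toLp 2 e‖ * |η| := by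
    intro p hp
    have hs := abs_measVec_dotProduct_le H hH p e
    have h2 := mul_gain_mul_neg_le hγ he hs
    have h3 := abs_gain_mul_sub_le hγ.le (r p) (-(measVec H p ⬝ᵥ e))
    rw [sub_neg_eq_add] at h3
    have h4 := h3.trans ((hr p (by simpa using hp)).trans (le_abs_self η))
    have h5 : (measVec H p ⬝ᵥ e) * (gain γ (r p) * r p
        - gain γ (-(measVec H p ⬝ᵥ e)) * -(measVec H p ⬝ᵥ e)) ≤ ‖WithLp.toLp 2 e‖ * |η| := by
      refine (le_abs_self _).trans ?_
      rw [abs_mul]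
      exact mul_le_mul hs h4 (abs_nonneg _) he0.le
    nlinarith
  have h2 := Finset.sum_le_sum hterm
  rw [Finset.sum_add_distrib, Finset.sum_neg_distrib, ← Finset.mul_sum, Finset.sum_const,
    nsmul_eq_mul] at h2
  have h3 := mul_le_mul_of_nonneg_left (lambdaMin_gramian_mul_le H Aᶜ e)
    (div_nonneg hγ.le he0.le)
  have h4 : γ / ‖WithLp.toLp 2 e‖ * (lambdaMin (gramian_isHermitian H Aᶜ) * ‖WithLp.toLp 2 e‖ ^ 2)
      = ‖WithLp.toLp 2 e‖ * (γ * lambdaMin (gramian_isHermitian H Aᶜ)) := by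
    field_simp
  rw [h4] at h3
  have h5 : ((Aᶜ.card : ℕ) : ℝ) * (‖WithLp.toLp 2 e‖ * |η|)
      ≤ Fintype.card (Stream P) * (‖WithLp.toLp 2 e‖ * |η|) := by
    refine mul_le_mul_of_nonneg_right ?_ (by positivity)
    exact_mod_cast Finset.card_le_univ _
  rw [← Finset.sum_add_sum_compl A]
  nlinarith

end Resilience

/-- Different components are averaged over different numbers of agents, so the Lyapunov function is
$\sum_m W_mE_m^2$: the weights cancel the divisors and leave the cross term $\langle E,g\rangle$, on
which the drift is known. -/
theorem exists_norm_le_mul_decay {M : ℕ} {E g : ℕ → Fin M → ℝ} {W : Fin M → ℝ} {a Γ τ₁ τ κ Q Z : ℝ}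
    (ha : 0 < a) (hΓ : 0 < Γ) (hτ₁ : 0 < τ₁) (hτ : 0 < τ) (hsum : τ₁ + τ < 1) (hκ : 0 < κ)
    (hW1 : ∀ m, 1 ≤ W m) (hWZ : ∀ m, W m ≤ Z) (hZ : 0 < Z)
    (hE : ∀ t m, E (t + 1) m = E t m + decay a τ₁ t * (g t m / W m))
    (hg : ∀ t m, |g t m| ≤ Q * decay Γ τ t)
    (hdrift : ∀ᶠ t in atTop, decay Γ τ t ≤ ‖WithLp.toLp 2 (E t)‖ →
      ∑ m, E t m * g t m ≤ -(κ * decay Γ τ t * ‖WithLp.toLp 2 (E t)‖)) :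
    ∃ B, ∀ᶠ t in atTop, ‖WithLp.toLp 2 (E t)‖ ≤ B * decay Γ τ t := by
  have hs1 : ∀ m, 1 ≤ √(W m) := fun m => Real.one_le_sqrt.2 (hW1 m)
  have hs0 : ∀ m, 0 < √(W m) := fun m => zero_lt_one.trans_le (hs1 m)
  have hsq : ∀ m, √(W m) ^ 2 = W m := fun m => Real.sq_sqrt (zero_le_one.trans (hW1 m))
  set U : ℕ → Fin M → ℝ := fun t m => √(W m) * E t m with hU
  set f : ℕ → Fin M → ℝ := fun t m => g t m / √(W m) with hf
  have hUE : ∀ t, ‖WithLp.toLp 2 (E t)‖ ≤ ‖WithLp.toLp 2 (U t)‖ := by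
    intro t
    refine abs_le_of_sq_le_sq' ?_ (norm_nonneg _) |>.2
    rw [norm_toLp_sq, norm_toLp_sq]
    refine Finset.sum_le_sum fun m _ => ?_
    simp only [hU, mul_pow, hsq]
    nlinarith [hW1 m, sq_nonneg (E t m)]
  have hEU : ∀ t, ‖WithLp.toLp 2 (U t)‖ ≤ √Z * ‖WithLp.toLp 2 (E t)‖ := by
    intro t
    refine abs_le_of_sq_le_sq' ?_ (by positivity) |>.2
    rw [mul_pow, Real.sq_sqrt hZ.le, norm_toLp_sq, norm_toLp_sq, Finset.mul_sum]
    refine Finset.sum_le_sum fun m _ => ?_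
    simp only [hU, mul_pow, hsq]
    exact mul_le_mul_of_nonneg_right (hWZ m) (sq_nonneg _)
  have hstep : ∀ t, U (t + 1) = U t + decay a τ₁ t • f t := by
    intro t
    ext m
    simp only [hU, hf, hE, Pi.add_apply, Pi.smul_apply, smul_eq_mul]
    have : g t m / W m = g t m / (√(W m) * √(W m)) := by rw [← sq, hsq]
    rw [this]
    field_simp [(hs0 m).ne']
  set D := (Fintype.card (Fin M) : ℝ) * Q with hD
  have hfn : ∀ t, ‖WithLp.toLp 2 (f t)‖ ≤ D * decay Γ τ t := by
    intro t
    rw [hD, mul_assoc]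
    refine norm_toLp_le_of_abs_le _ fun m => ?_
    simp only [hf]
    rw [abs_div, abs_of_pos (hs0 m)]
    exact (div_le_self (abs_nonneg _) (hs1 m)).trans (hg t m)
  have hup : ∀ t, ‖WithLp.toLp 2 (U (t + 1))‖
      ≤ ‖WithLp.toLp 2 (U t)‖ + D * (decay a τ₁ t * decay Γ τ t) := by
    intro t
    rw [hstep, WithLp.toLp_add, WithLp.toLp_smul]
    refine (norm_add_le _ _).trans (add_le_add_right ?_ _)
    rw [norm_smul, Real.norm_of_nonneg (decay_nonneg ha.le _ _)]
    have := mul_le_mul_of_nonneg_left (hfn t) (decay_nonneg ha.le τ₁ t)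
    linarith
  set K := √Z with hK
  have hK0 : 0 < K := Real.sqrt_pos.2 hZ
  have e1 : ∀ᶠ t in atTop, decay a τ₁ t * D ^ 2 ≤ κ := by
    have h := (tendsto_decay a hτ₁).mul_const (D ^ 2)
    rw [zero_mul] at h
    exact h.eventually_le_const hκ
  have e2 : ∀ᶠ t in atTop, κ / (2 * K) * decay a τ₁ t ≤ K := by
    have h := (tendsto_decay a hτ₁).const_mul (κ / (2 * K))
    rw [mul_zero] at h
    exact h.eventually_le_const hK0
  obtain ⟨B, hB⟩ := exists_le_mul_decay_of_drift (u := fun t => ‖WithLp.toLp 2 (U t)‖)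
    (fun t => norm_nonneg _) ha hΓ hτ₁ hτ hsum (c := κ / (2 * K)) (by positivity) hK0 hup (by
      filter_upwards [e1, e2, hdrift] with t h1 h2 h3 hKu
      have hγ := decay_pos hΓ τ t
      have hα := decay_pos ha τ₁ t
      set γ := decay Γ τ t
      set α := decay a τ₁ t
      set u := ‖WithLp.toLp 2 (U t)‖ with hu
      set x := ‖WithLp.toLp 2 (E t)‖ with hx
      have hux : u ≤ K * x := hEU t
      have hγx : γ ≤ x := le_of_mul_le_mul_left (hKu.trans hux) hK0
      have h4 := h3 hγx
      have h5 : ‖WithLp.toLp 2 (U (t + 1))‖ ^ 2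
          = u ^ 2 + 2 * α * ∑ m, E t m * g t m + α ^ 2 * ‖WithLp.toLp 2 (f t)‖ ^ 2 := by
        rw [hu, norm_toLp_sq, norm_toLp_sq, norm_toLp_sq, Finset.mul_sum, Finset.mul_sum,
          ← Finset.sum_add_distrib, ← Finset.sum_add_distrib]
        refine Finset.sum_congr rfl fun m _ => ?_
        rw [hstep]
        simp only [hU, hf, Pi.add_apply, Pi.smul_apply, smul_eq_mul]
        field_simp [(hs0 m).ne']
        ring
      have h6 : ‖WithLp.toLp 2 (f t)‖ ^ 2 ≤ (D * γ) ^ 2 :=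
        pow_le_pow_left₀ (norm_nonneg _) (hfn t) 2
      -- With this $c$ the cross term gains at least $4c\alpha\gamma u$. Half of it pays for the
      -- second-order term once $\alpha D^2\le\kappa$, and $u^2-2c\alpha\gamma
      -- u\le(u-c\alpha\gamma)^2$.
      set c := κ / (2 * K) with hc
      have hcK : κ = 2 * c * K := by rw [hc]; field_simp
      have hc0 : 0 < c := by positivity
      have h7 : α * γ * (4 * c * u) ≤ 2 * α * (κ * γ * x) := by
        rw [hcK]
        have := mul_le_mul_of_nonneg_left hux (by positivity : 0 ≤ 4 * c * (α * γ))
        nlinarith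
      have h8 : α ^ 2 * (D * γ) ^ 2 ≤ α * γ * (2 * c * u) := by
        calc α ^ 2 * (D * γ) ^ 2 = α * γ * (α * D ^ 2 * γ) := by ring
          _ ≤ α * γ * (κ * γ) := by gcongr
          _ = α * γ * (2 * c * (K * γ)) := by rw [hcK]; ring
          _ ≤ α * γ * (2 * c * u) := by gcongr
      have h9 : α ^ 2 * ‖WithLp.toLp 2 (f t)‖ ^ 2 ≤ α ^ 2 * (D * γ) ^ 2 :=
        mul_le_mul_of_nonneg_left h6 (sq_nonneg _)
      have h10 : 2 * α * ∑ m, E t m * g t m ≤ 2 * α * -(κ * γ * x) :=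
        mul_le_mul_of_nonneg_left h4 (by positivity)
      have h11 : 0 ≤ u - c * (α * γ) := by
        have := mul_le_mul_of_nonneg_right h2 hγ.le
        nlinarith
      refine abs_le_of_sq_le_sq' ?_ h11 |>.2
      rw [h5]
      nlinarith [sq_nonneg (c * (α * γ))])
  exact ⟨B, hB.mono fun t ht => (hUE t).trans ht⟩

/-! ### The algorithm, component by component -/

section Network

variable {N M : ℕ} {P : Fin N → ℕ} (S : Params) (H : ∀ n, Matrix (Fin (P n)) (Fin M) ℝ)
  (I : Fin N → Finset (Fin M)) (G : ℕ → SimpleGraph (Fin N))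
  (y : ∀ n : Fin N, ℕ → Fin (P n) → ℝ)

/-- The estimates of component `m` by all agents, with zeros for the agents not interested in it. -/
noncomputable def componentEstimate (m : Fin M) (t : ℕ) (n : Fin N) : ℝ :=
  if h : m ∈ I n then estimate S H I G y t n ⟨m, h⟩ else 0

/-- The innovation of a stream. -/
noncomputable def innovation (t : ℕ) (p : Stream P) : ℝ :=
  timeAverage (y p.1) t p.2 - ∑ m, H p.1 p.2 m * componentEstimate S H I G y m t p.1

/-- The clipped innovations of an agent, as they enter its estimate of component `m`. -/
noncomputable def correction (m : Fin M) (t : ℕ) (n : Fin N) : ℝ :=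
  ∑ i, H n i m * (gain (decay S.Γ S.τγ t) (innovation S H I G y t ⟨n, i⟩)
    * innovation S H I G y t ⟨n, i⟩)

variable {H I} in
theorem entry_eq_zero (hI_sub : ∀ n, couplingSet (H n) ⊆ (I n : Set (Fin M))) {n : Fin N}
    {m : Fin M} (hm : m ∉ I n) (i : Fin (P n)) : H n i m = 0 := by
  by_contra h
  refine hm (hI_sub n fun h0 => h ?_)
  have := congrFun h0 i
  simpa using this

theorem mem_interestedAgents {I : Fin N → Finset (Fin M)} {m : Fin M} {n : Fin N} :
    n ∈ interestedAgents I m ↔ m ∈ I n := by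
  simp [interestedAgents]

theorem componentEstimate_eq_zero {m : Fin M} (t : ℕ) {n : Fin N}
    (hn : n ∉ interestedAgents I m) : componentEstimate S H I G y m t n = 0 := by
  rw [mem_interestedAgents] at hn
  simp [componentEstimate, hn]

variable {H I} in
theorem correction_eq_zero (hI_sub : ∀ n, couplingSet (H n) ⊆ (I n : Set (Fin M))) {m : Fin M}
    (t : ℕ) {n : Fin N} (hn : n ∉ interestedAgents I m) : correction S H I G y m t n = 0 := by
  rw [mem_interestedAgents] at hn
  simp [correction, entry_eq_zero hI_sub hn]

variable {H I} in
-- Censoring loses nothing: a column outside the interest set is zero, since the coupling set lies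
-- inside it.
theorem censoredMatrix_mulVec (hI_sub : ∀ n, couplingSet (H n) ⊆ (I n : Set (Fin M))) (t : ℕ)
    (n : Fin N) (i : Fin (P n)) :
    (censoredMatrix (H n) (I n)).mulVec (estimate S H I G y t n) i
      = ∑ m, H n i m * componentEstimate S H I G y m t n := by
  have h : ∑ m, H n i m * componentEstimate S H I G y m t n
      = ∑ m ∈ I n, H n i m * componentEstimate S H I G y m t n :=
    (Finset.sum_subset (Finset.subset_univ _) fun m _ hm => by
      rw [entry_eq_zero hI_sub hm, zero_mul]).symm
  rw [h, ← Finset.sum_coe_sort (I n)]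
  simp [Matrix.mulVec, dotProduct, censoredMatrix, componentEstimate]

variable {H I} in
-- Both messages vanish in components the neighbour does not track, so component $m$ is exchanged
-- exactly along the edges of the subgraph induced by $\mathcal J_m$. The components interact only
-- through the innovations.
theorem componentEstimate_succ (hI_sub : ∀ n, couplingSet (H n) ⊆ (I n : Set (Fin M)))
    (m : Fin M) (t : ℕ) :
    componentEstimate S H I G y m (t + 1)
      = averagingStep (edgeWeight (interestedAgents I m) (G t)) (decay S.b S.τ₂ t)
          (componentEstimate S H I G y m t)
        + decay S.a S.τ₁ t • correction S H I G y m t := by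
  classical
  ext n
  by_cases hm : m ∈ I n
  · have hdiff : (∑ l ∈ (G t).neighborFinset n,
        (processOwn (I n) (I l) (estimate S H I G y t n)
          - censor (I n) (I l) (estimate S H I G y t l))) ⟨m, hm⟩
        = diffusion (edgeWeight (interestedAgents I m) (G t))
          (componentEstimate S H I G y m t) n := by
      rw [diffusion, Finset.sum_apply, SimpleGraph.neighborFinset_eq_filter, Finset.sum_filter]
      refine Finset.sum_congr rfl fun l _ => ?_
      by_cases hadj : (G t).Adj n l <;> by_cases hl : m ∈ I l <;>
        simp [edgeWeight, mem_interestedAgents, hm, hadj, hl, processOwn, censor, componentEstimate]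
    have hcorr : ((censoredMatrix (H n) (I n)).transpose.mulVec
        ((gainMatrix (decay S.Γ S.τγ t) (timeAverage (y n) t
          - (censoredMatrix (H n) (I n)).mulVec (estimate S H I G y t n))).mulVec
          (timeAverage (y n) t
            - (censoredMatrix (H n) (I n)).mulVec (estimate S H I G y t n)))) ⟨m, hm⟩
        = correction S H I G y m t n := by
      rw [correction, Matrix.mulVec, dotProduct]
      refine Finset.sum_congr rfl fun i _ => ?_
      simp only [gainMatrix, Matrix.mulVec_diagonal, Pi.sub_apply,
        censoredMatrix_mulVec S G y hI_sub, innovation]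
      rfl
    simp only [averagingStep, Pi.add_apply, Pi.sub_apply, Pi.smul_apply, smul_eq_mul]
    rw [← hdiff, ← hcorr]
    simp only [componentEstimate, hm, dif_pos, estimate, Pi.add_apply, Pi.sub_apply, Pi.smul_apply,
      smul_eq_mul]
  · have hn : n ∉ interestedAgents I m := fun h => hm (mem_interestedAgents.1 h)
    rw [componentEstimate_eq_zero S H I G y _ hn, Pi.add_apply, Pi.smul_apply,
      correction_eq_zero S G y hI_sub t hn,
      averagingStep_support (fun i j hi => edgeWeight_eq_zero _ _ hi) _
        (fun i hi => componentEstimate_eq_zero S H I G y t hi) hn]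
    simp

end Network

/-! ### Convergence on a fixed sample path -/

section Convergence

variable {N M : ℕ} {P : Fin N → ℕ} {S : Params} {H : ∀ n, Matrix (Fin (P n)) (Fin M) ℝ}
  {I : Fin N → Finset (Fin M)} {G : ℕ → SimpleGraph (Fin N)}

/-- Entries of unit vectors and clipping bound the correction regardless of the attack; this is the
only information about the attack that consensus needs. -/
theorem abs_correction_le (hH : ∀ p : Stream P, ‖WithLp.toLp 2 (measVec H p)‖ = 1)
    (hΓ : 0 < S.Γ) (y : ∀ n : Fin N, ℕ → Fin (P n) → ℝ) (m : Fin M) (t : ℕ) (n : Fin N) :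
    |correction S H I G y m t n| ≤ (∑ n, P n : ℕ) * decay S.Γ S.τγ t := by
  have hγ := decay_nonneg hΓ.le S.τγ t
  calc |correction S H I G y m t n| ≤ ∑ _i : Fin (P n), decay S.Γ S.τγ t := by
        refine (Finset.abs_sum_le_sum_abs _ _).trans (Finset.sum_le_sum fun i _ => ?_)
        rw [abs_mul, ← one_mul (decay S.Γ S.τγ t)]
        exact mul_le_mul (abs_measVec_le H hH ⟨n, i⟩ m)
          ((abs_gain_mul_le (by simpa using hγ) _).trans (by simp)) (abs_nonneg _) zero_le_one
    _ = P n * decay S.Γ S.τγ t := by simp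
    _ ≤ _ := by
        refine mul_le_mul_of_nonneg_right ?_ hγ
        exact_mod_cast Finset.single_le_sum (f := P) (fun _ _ => Nat.zero_le _) (Finset.mem_univ n)

theorem abs_center_le {ι : Type*} [Fintype ι] [DecidableEq ι] (J : Finset ι) {z : ι → ℝ} {B : ℝ}
    (hB : 0 ≤ B) (hz : ∀ i, |z i| ≤ B) (i : ι) : |center J z i| ≤ 2 * B := by
  unfold center
  split_ifs with hi
  · have hJ : (0 : ℝ) < J.card := by exact_mod_cast Finset.card_pos.2 ⟨i, hi⟩
    have h1 : |(∑ j ∈ J, z j) / J.card| ≤ B := by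
      rw [abs_div, abs_of_pos hJ, div_le_iff₀ hJ]
      calc _ ≤ ∑ _j ∈ J, B :=
            (Finset.abs_sum_le_sum_abs _ _).trans (Finset.sum_le_sum fun j _ => hz j)
        _ = _ := by simp [mul_comm]
    have h2 := abs_sub (z i) ((∑ j ∈ J, z j) / J.card)
    linarith [hz i]
  · simpa using hB

theorem decay_mul_decay (a c τ τ' : ℝ) (t : ℕ) :
    decay a τ t * decay c τ' t = decay (a * c) (τ + τ') t := by
  rw [decay, decay, decay, Real.rpow_add (by positivity)]
  field_simp

/-- The agents interested in a component reach consensus on it faster than the threshold decays. -/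
theorem tendsto_center_componentEstimate (hS : S.Admissible)
    (hH : ∀ p : Stream P, ‖WithLp.toLp 2 (measVec H p)‖ = 1)
    (hI_sub : ∀ n, couplingSet (H n) ⊆ (I n : Set (Fin M)))
    (y : ∀ n : Fin N, ℕ → Fin (P n) → ℝ) (m : Fin M)
    (hflow : ∀ i, Tendsto (fun t : ℕ => ((t : ℝ) + 1) ^ 2 * ‖WithLp.toLp 2 (flow
      (fun t => edgeWeight (interestedAgents I m) (G t)) (decay S.b S.τ₂)
      (t - window ((S.τ₁ + S.τ₂) / 2) t) (center (interestedAgents I m) (Pi.single i 1))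
      (window ((S.τ₁ + S.τ₂) / 2) t))‖) atTop (𝓝 0)) :
    Tendsto (fun t : ℕ => ((t : ℝ) + 1) ^ S.τγ * ‖WithLp.toLp 2
      (center (interestedAgents I m) (componentEstimate S H I G y m t))‖) atTop (𝓝 0) := by
  obtain ⟨ha, hb, hΓ, hτ₂, h21, h1, hτγ, hmin⟩ := hS
  have hτγ2 := hmin.trans_le (min_le_left _ _)
  set J := interestedAgents I m with hJ
  -- The perturbation has order $\sigma=\tau_1+\tau_\gamma$. The exponent $\rho=(\tau_1+\tau_2)/2$
  -- lies above $\tau_2$, so that the network forgets, and below $\tau_1$, so that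
  -- $\rho+\tau_\gamma<\sigma$.
  refine tendsto_disagreement (J := J) (c := fun t => edgeWeight J (G t))
    (e := fun t => center J (decay S.a S.τ₁ t • correction S H I G y m t))
    (K := N * (2 * ((∑ n, P n : ℕ) * (S.a * S.Γ)))) (σ := S.τ₁ + S.τγ)
    (fun t => edgeWeight_comm _ _) (fun t => edgeWeight_nonneg _ _)
    (fun t => edgeWeight_le_one _ _) hb hτ₂ (by linarith) (by linarith) (by linarith)
    (by linarith) (by linarith) (fun t => ?_) (fun t i hi => by simp [center, hi])
    (fun t => sum_center _ _) (fun t => ?_) hflow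
  · rw [componentEstimate_succ S G y hI_sub]
    exact center_averagingStep_add (edgeWeight_comm _ _)
      (fun i j hi => edgeWeight_eq_zero _ _ hi) _ _ _
  · have h := decay_mul_decay S.a S.Γ S.τ₁ S.τγ t
    have hα := decay_nonneg ha.le S.τ₁ t
    have hγ := decay_nonneg hΓ.le S.τγ t
    have hb : ∀ n, |(decay S.a S.τ₁ t • correction S H I G y m t) n|
        ≤ (∑ n, P n : ℕ) * decay (S.a * S.Γ) (S.τ₁ + S.τγ) t := by
      intro n
      rw [Pi.smul_apply, smul_eq_mul, abs_mul, abs_of_nonneg hα, ← h]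
      calc _ ≤ decay S.a S.τ₁ t * ((∑ n, P n : ℕ) * decay S.Γ S.τγ t) :=
            mul_le_mul_of_nonneg_left (abs_correction_le hH hΓ y m t n) hα
        _ = _ := by ring
    refine (norm_toLp_le_of_abs_le _ fun n => abs_center_le J ?_ hb n).trans (le_of_eq ?_)
    · rw [← h]; positivity
    · simp only [decay, Fintype.card_fin]; ring

variable (S H I G) in
/-- The error of the average estimate of each component, over the agents interested in it. -/
noncomputable def averageError (θ : Fin M → ℝ) (y : ∀ n : Fin N, ℕ → Fin (P n) → ℝ) (t : ℕ)
    (m : Fin M) : ℝ :=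
  (∑ n ∈ interestedAgents I m, componentEstimate S H I G y m t n) / (interestedAgents I m).card
    - θ m

theorem componentEstimate_eq (θ : Fin M → ℝ) (y : ∀ n : Fin N, ℕ → Fin (P n) → ℝ) (t : ℕ)
    {m : Fin M} {n : Fin N} (hn : n ∈ interestedAgents I m) :
    componentEstimate S H I G y m t n = θ m + averageError S H I G θ y t m
      + center (interestedAgents I m) (componentEstimate S H I G y m t) n := by
  simp only [averageError, center, hn, if_true]
  ring

/-- Symmetric weights conserve the sum over the interested agents, so the graph drops out of the
recursion except through the innovations. -/
theorem averageError_succ (hI_sub : ∀ n, couplingSet (H n) ⊆ (I n : Set (Fin M)))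
    (θ : Fin M → ℝ) (y : ∀ n : Fin N, ℕ → Fin (P n) → ℝ) (t : ℕ) (m : Fin M) :
    averageError S H I G θ y (t + 1) m = averageError S H I G θ y t m + decay S.a S.τ₁ t
      * ((∑ p : Stream P, measVec H p m * (gain (decay S.Γ S.τγ t) (innovation S H I G y t p)
        * innovation S H I G y t p)) / (interestedAgents I m).card) := by
  have hsum : ∀ f : Fin N → ℝ, (∀ n, n ∉ interestedAgents I m → f n = 0) →
      ∑ n ∈ interestedAgents I m, f n = ∑ n, f n :=
    fun f hf => Finset.sum_subset (Finset.subset_univ _) fun n _ hn => hf n hn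
  have h1 : ∑ p : Stream P, measVec H p m * (gain (decay S.Γ S.τγ t) (innovation S H I G y t p)
      * innovation S H I G y t p) = ∑ n, correction S H I G y m t n := by
    rw [Fintype.sum_sigma]; rfl
  unfold averageError
  rw [h1, hsum _ fun n hn => componentEstimate_eq_zero S H I G y _ hn,
    hsum _ fun n hn => componentEstimate_eq_zero S H I G y _ hn,
    componentEstimate_succ S G y hI_sub]
  simp only [Pi.add_apply, Pi.smul_apply, smul_eq_mul, Finset.sum_add_distrib,
    sum_averagingStep (edgeWeight_comm _ _), ← Finset.mul_sum]
  ring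

theorem timeAverage_measurement (θ : Fin M → ℝ) (w a : ∀ n : Fin N, ℕ → Fin (P n) → ℝ) (n : Fin N)
    (t : ℕ) (i : Fin (P n)) : timeAverage (measurement H θ w a n) t i
      = measVec H ⟨n, i⟩ ⬝ᵥ θ + timeAverage (w n) t i + timeAverage (a n) t i := by
  simp only [timeAverage_eq, measurement, Pi.add_apply, Finset.sum_add_distrib, Finset.sum_const,
    Finset.card_range, nsmul_eq_mul]
  have : (H n).mulVec θ i = measVec H ⟨n, i⟩ ⬝ᵥ θ := rfl
  rw [this]
  push_cast
  field_simp

/-- The innovation of an uncompromised stream. -/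
theorem innovation_add (hI_sub : ∀ n, couplingSet (H n) ⊆ (I n : Set (Fin M)))
    (θ : Fin M → ℝ) (w a : ∀ n : Fin N, ℕ → Fin (P n) → ℝ) (t : ℕ) {p : Stream P}
    (hp : p ∉ compromised a) :
    innovation S H I G (measurement H θ w a) t p
        + measVec H p ⬝ᵥ averageError S H I G θ (measurement H θ w a) t
      = timeAverage (w p.1) t p.2 - ∑ m, measVec H p m * center (interestedAgents I m)
          (componentEstimate S H I G (measurement H θ w a) m t) p.1 := by
  have ha : timeAverage (a p.1) t p.2 = 0 := by
    rw [timeAverage_eq]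
    have : ∀ s, a p.1 s p.2 = 0 := by simpa [compromised] using hp
    simp [this]
  have hsum : ∑ m, H p.1 p.2 m * componentEstimate S H I G (measurement H θ w a) m t p.1
      = measVec H p ⬝ᵥ θ + measVec H p ⬝ᵥ averageError S H I G θ (measurement H θ w a) t
        + ∑ m, measVec H p m * center (interestedAgents I m)
          (componentEstimate S H I G (measurement H θ w a) m t) p.1 := by
    simp only [dotProduct, ← Finset.sum_add_distrib]
    refine Finset.sum_congr rfl fun m _ => ?_
    by_cases hm : m ∈ I p.1
    · rw [componentEstimate_eq θ _ t (mem_interestedAgents.2 hm), measVec]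
      ring
    · have := entry_eq_zero hI_sub hm p.2
      simp [measVec, this]
  rw [innovation, hsum, timeAverage_measurement, ha]
  ring

theorem exists_norm_averageError_le (hS : S.Admissible)
    (hH : ∀ p : Stream P, ‖WithLp.toLp 2 (measVec H p)‖ = 1)
    (hI_sub : ∀ n, couplingSet (H n) ⊆ (I n : Set (Fin M)))
    (hI_cover : ∀ m, 0 < (interestedAgents I m).card) (hN : 0 < N) (θ : Fin M → ℝ)
    {w a : ∀ n : Fin N, ℕ → Fin (P n) → ℝ} (hres : Resilient H (compromised a))
    (hnoise : ∀ n i, Tendsto (fun t : ℕ => ((t : ℝ) + 1) ^ S.τγ * timeAverage (w n) t i)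
      atTop (𝓝 0))
    (hcons : ∀ m, Tendsto (fun t : ℕ => ((t : ℝ) + 1) ^ S.τγ * ‖WithLp.toLp 2
      (center (interestedAgents I m) (componentEstimate S H I G (measurement H θ w a) m t))‖)
      atTop (𝓝 0)) :
    ∃ B, ∀ᶠ t in atTop, ‖WithLp.toLp 2 (averageError S H I G θ (measurement H θ w a) t)‖
      ≤ B * decay S.Γ S.τγ t := by
  obtain ⟨ha, hb, hΓ, hτ₂, h21, h1, hτγ, hmin⟩ := hS
  have hτγ2 := hmin.trans_le ((min_le_right _ _).trans (min_le_right _ _))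
  set y := measurement H θ w a with hy
  set A := compromised a with hA
  have hκ : 0 < lambdaMin (gramian_isHermitian H Aᶜ) - attackStrength H A := sub_pos.2 hres
  set κ := lambdaMin (gramian_isHermitian H Aᶜ) - attackStrength H A with hκdef
  -- A common bound for the deviation of honest innovations from $-h_p^\top E$: averaged noise plus
  -- disagreement, both negligible against $\gamma_t$.
  set η : ℕ → ℝ := fun t => ∑ p : Stream P, |timeAverage (w p.1) t p.2|
    + ∑ m, ‖WithLp.toLp 2 (center (interestedAgents I m) (componentEstimate S H I G y m t))‖ with hη
  have hη0 : ∀ t, 0 ≤ η t := fun t => add_nonneg (Finset.sum_nonneg fun _ _ => abs_nonneg _)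
    (Finset.sum_nonneg fun _ _ => norm_nonneg _)
  have hηlim : Tendsto (fun t : ℕ => ((t : ℝ) + 1) ^ S.τγ * η t) atTop (𝓝 0) := by
    have hA := tendsto_finsetSum (Finset.univ : Finset (Stream P))
      fun p _ => (hnoise p.1 p.2).abs
    have hB := tendsto_finsetSum (Finset.univ : Finset (Fin M)) fun m _ => hcons m
    have := hA.add hB
    simp only [abs_zero, Finset.sum_const_zero, add_zero] at this
    refine this.congr fun t => ?_
    simp only [hη, mul_add, Finset.mul_sum, abs_mul]
    congr 1
    refine Finset.sum_congr rfl fun p _ => ?_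
    rw [abs_of_nonneg (by positivity : (0 : ℝ) ≤ ((t : ℝ) + 1) ^ S.τγ)]
  refine exists_norm_le_mul_decay (W := fun m => ((interestedAgents I m).card : ℝ)) (Z := N)
    (g := fun t m => ∑ p : Stream P, measVec H p m
      * (gain (decay S.Γ S.τγ t) (innovation S H I G y t p) * innovation S H I G y t p))
    (Q := Fintype.card (Stream P)) (κ := κ / 2)
    ha hΓ (hτ₂.trans h21) hτγ (by linarith) (by positivity)
    (fun m => by exact_mod_cast hI_cover m) (fun m => ?_) (by exact_mod_cast hN)
    (fun t m => averageError_succ hI_sub θ y t m) (fun t m => ?_) ?_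
  · exact_mod_cast (Finset.card_le_univ _).trans (Fintype.card_fin N).le
  · calc _ ≤ ∑ _p : Stream P, decay S.Γ S.τγ t := by
          refine (Finset.abs_sum_le_sum_abs _ _).trans (Finset.sum_le_sum fun p _ => ?_)
          rw [abs_mul, ← one_mul (decay S.Γ S.τγ t)]
          exact mul_le_mul (abs_measVec_le H hH p m)
            ((abs_gain_mul_le (by simpa using decay_nonneg hΓ.le _ _) _).trans (by simp))
            (abs_nonneg _) zero_le_one
      _ = _ := by simp
  · have h := hηlim.const_mul (Fintype.card (Stream P) : ℝ)
    rw [mul_zero] at h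
    -- Half of the resilience margin is spent on $\eta$; the other half, $\kappa/2$, remains as
    -- drift.
    filter_upwards [h.eventually_le_const (by positivity : 0 < S.Γ * (κ / 2))] with t ht hfar
    have hγ := decay_pos hΓ S.τγ t
    have hstep := sum_measVec_mul_le H hH A hγ hfar (r := innovation S H I G y t) (η := η t)
      (fun p hp => by
        rw [hy, innovation_add hI_sub θ w a t hp, ← hy]
        refine (abs_sub _ _).trans (add_le_add ?_ ?_)
        · exact Finset.single_le_sum (f := fun p : Stream P => |timeAverage (w p.1) t p.2|)
            (fun _ _ => abs_nonneg _) (Finset.mem_univ p)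
        · refine (Finset.abs_sum_le_sum_abs _ _).trans (Finset.sum_le_sum fun m _ => ?_)
          rw [abs_mul, ← one_mul (‖_‖ : ℝ)]
          exact mul_le_mul (abs_measVec_le H hH p m) (abs_le_norm_toLp _ _) (abs_nonneg _)
            zero_le_one)
    have hswap : ∑ m, averageError S H I G θ y t m * ∑ p : Stream P, measVec H p m
        * (gain (decay S.Γ S.τγ t) (innovation S H I G y t p) * innovation S H I G y t p)
        = ∑ p : Stream P, (measVec H p ⬝ᵥ averageError S H I G θ y t)
          * (gain (decay S.Γ S.τγ t) (innovation S H I G y t p) * innovation S H I G y t p) := by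
      simp only [dotProduct, Finset.mul_sum, Finset.sum_mul]
      rw [Finset.sum_comm]
      exact Finset.sum_congr rfl fun p _ => Finset.sum_congr rfl fun m _ => by ring
    rw [hswap]
    refine hstep.trans ?_
    have hpη : (Fintype.card (Stream P) : ℝ) * |η t| ≤ κ / 2 * decay S.Γ S.τγ t := by
      rw [abs_of_nonneg (hη0 t), decay, ← mul_div_assoc, le_div_iff₀ (by positivity)]
      linarith
    have hx := norm_nonneg (WithLp.toLp 2 (averageError S H I G θ y t))
    have : decay S.Γ S.τγ t * attackStrength H A
        - decay S.Γ S.τγ t * lambdaMin (gramian_isHermitian H Aᶜ)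
        + Fintype.card (Stream P) * |η t| ≤ -(κ / 2 * decay S.Γ S.τγ t) := by
      rw [hκdef] at hpη ⊢
      linarith
    have := mul_le_mul_of_nonneg_left this hx
    linarith

/-- An agent's error is the average error, which is $O(\gamma_t)$, plus its disagreement, which is
$o((t+1)^{-\tau_\gamma})$. No measurability of the attack enters, since the path is fixed. -/
theorem tendsto_estimate_sub (hS : S.Admissible)
    (hH : ∀ p : Stream P, ‖WithLp.toLp 2 (measVec H p)‖ = 1)
    (hI_sub : ∀ n, couplingSet (H n) ⊆ (I n : Set (Fin M)))
    (hI_cover : ∀ m, 0 < (interestedAgents I m).card) (θ : Fin M → ℝ)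
    {w a : ∀ n : Fin N, ℕ → Fin (P n) → ℝ} (hres : Resilient H (compromised a))
    (hnoise : ∀ n i, Tendsto (fun t : ℕ => ((t : ℝ) + 1) ^ S.τγ * timeAverage (w n) t i)
      atTop (𝓝 0))
    (hflow : ∀ m i, Tendsto (fun t : ℕ => ((t : ℝ) + 1) ^ 2 * ‖WithLp.toLp 2 (flow
      (fun t => edgeWeight (interestedAgents I m) (G t)) (decay S.b S.τ₂)
      (t - window ((S.τ₁ + S.τ₂) / 2) t) (center (interestedAgents I m) (Pi.single i 1))
      (window ((S.τ₁ + S.τ₂) / 2) t))‖) atTop (𝓝 0))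
    (n : Fin N) {τ₀ : ℝ} (hτ₀ : τ₀ < S.τγ) :
    Tendsto (fun t : ℕ => ((t : ℝ) + 1) ^ τ₀ * ‖WithLp.toLp 2
      (estimate S H I G (measurement H θ w a) t n - restrictTo (I n) θ)‖) atTop (𝓝 0) := by
  have hcons := fun m => tendsto_center_componentEstimate hS hH hI_sub (measurement H θ w a) m
    (hflow m)
  obtain ⟨B, hB⟩ := exists_norm_averageError_le hS hH hI_sub hI_cover (Fin.pos n) θ hres hnoise hcons
  set y := measurement H θ w a with hy
  have hlim : Tendsto (fun t : ℕ => (Fintype.card (I n) : ℝ)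
      * (B * S.Γ * ((t : ℝ) + 1) ^ (-(S.τγ - τ₀)) + ∑ m, ((t : ℝ) + 1) ^ S.τγ * ‖WithLp.toLp 2
        (center (interestedAgents I m) (componentEstimate S H I G y m t))‖)) atTop (𝓝 0) := by
    have hA := (tendsto_add_one_rpow_neg (sub_pos.2 hτ₀)).const_mul (B * S.Γ)
    have hC := tendsto_finsetSum (Finset.univ : Finset (Fin M)) fun m _ => hcons m
    simpa using (hA.add hC).const_mul (Fintype.card (I n) : ℝ)
  refine squeeze_zero' (Eventually.of_forall fun t => by positivity) ?_ hlim
  filter_upwards [hB] with t ht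
  have hpos : (0 : ℝ) < (t : ℝ) + 1 := by positivity
  have hcomp : ∀ i : I n, |(estimate S H I G y t n - restrictTo (I n) θ) i|
      ≤ B * decay S.Γ S.τγ t + ∑ m, ‖WithLp.toLp 2
        (center (interestedAgents I m) (componentEstimate S H I G y m t))‖ := by
    intro i
    have h1 : (estimate S H I G y t n - restrictTo (I n) θ) i
        = averageError S H I G θ y t i + center (interestedAgents I (i : Fin M))
          (componentEstimate S H I G y (i : Fin M) t) n := by
      have h2 := componentEstimate_eq (S := S) (H := H) (G := G) θ y t
        (mem_interestedAgents.2 i.2)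
      have h3 : componentEstimate S H I G y i t n = estimate S H I G y t n i := by
        simp [componentEstimate]
      rw [Pi.sub_apply, ← h3, h2, restrictTo]
      ring
    rw [h1]
    refine (abs_add_le _ _).trans (add_le_add ((abs_le_norm_toLp _ _).trans ht) ?_)
    refine (abs_le_norm_toLp _ n).trans ?_
    exact Finset.single_le_sum (f := fun m => ‖WithLp.toLp 2
      (center (interestedAgents I m) (componentEstimate S H I G y m t))‖)
      (fun _ _ => norm_nonneg _) (Finset.mem_univ (i : Fin M))
  have hnorm := norm_toLp_le_of_abs_le _ hcomp
  have hp : ((t : ℝ) + 1) ^ τ₀ ≤ ((t : ℝ) + 1) ^ S.τγ :=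
    Real.rpow_le_rpow_of_exponent_le (by linarith [t.cast_nonneg (α := ℝ)]) hτ₀.le
  have hsplit : ((t : ℝ) + 1) ^ τ₀ * decay S.Γ S.τγ t
      = S.Γ * ((t : ℝ) + 1) ^ (-(S.τγ - τ₀)) := by
    rw [decay_eq, show -(S.τγ - τ₀) = τ₀ + -S.τγ by ring, Real.rpow_add hpos]; ring
  rw [← Finset.mul_sum]
  set D := ∑ m, ‖WithLp.toLp 2
    (center (interestedAgents I m) (componentEstimate S H I G y m t))‖ with hD
  have hD0 : 0 ≤ D := Finset.sum_nonneg fun _ _ => norm_nonneg _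
  calc _ ≤ ((t : ℝ) + 1) ^ τ₀ * (Fintype.card (I n) * (B * decay S.Γ S.τγ t + D)) :=
        mul_le_mul_of_nonneg_left hnorm (by positivity)
    _ = Fintype.card (I n) * (B * (((t : ℝ) + 1) ^ τ₀ * decay S.Γ S.τγ t)
        + ((t : ℝ) + 1) ^ τ₀ * D) := by ring
    _ ≤ Fintype.card (I n) * (B * (((t : ℝ) + 1) ^ τ₀ * decay S.Γ S.τγ t)
        + ((t : ℝ) + 1) ^ S.τγ * D) := by gcongr
    _ = _ := by rw [hsplit]; ring

end Convergence

/-! ### Passage to almost every sample path -/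

section AlmostSure

variable {N : ℕ} {Ω : Type*} [MeasurableSpace Ω] {μ : Measure Ω}

/-- Equal laws give equal mean weights, so the spectral gap at time $0$ serves uniformly in time. -/
theorem integral_edgeWeight_eq {G G' : Ω → SimpleGraph (Fin N)}
    (h : IdentDistrib (fun ω => laplacianEntries (G ω)) (fun ω => laplacianEntries (G' ω)) μ μ)
    (J : Finset (Fin N)) (i j : Fin N) :
    ∫ ω, edgeWeight J (G ω) i j ∂μ = ∫ ω, edgeWeight J (G' ω) i j ∂μ := by
  simp only [← weightOfEntries_laplacianEntries]
  exact (h.comp (measurable_weightOfEntries J i j)).integral_eq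

end AlmostSure

end SAFE

theorem theorem1
    -- sizes, field, measurement matrices, interest sets, algorithm parameters
    {N M : ℕ} (P : Fin N → ℕ) (H : ∀ n, Matrix (Fin (P n)) (Fin M) ℝ) (θ : Fin M → ℝ)
    (I : Fin N → Finset (Fin M)) (S : SAFE.Params) (hS : S.Admissible)
    -- random graphs, noises, and arbitrary (deterministic or random) attacks
    {Ω : Type*} [MeasurableSpace Ω] (μ : Measure Ω) [IsProbabilityMeasure μ]
    (G : ℕ → Ω → SimpleGraph (Fin N))
    (w : ∀ n : Fin N, ℕ → Ω → Fin (P n) → ℝ)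
    (a : ∀ n : Fin N, ℕ → Ω → Fin (P n) → ℝ)
    -- noise: i.i.d. in time, zero mean, covariance `C n`, independent across agents,
    -- independent of the past
    (C : ∀ n, Matrix (Fin (P n)) (Fin (P n)) ℝ)
    (hw_meas : ∀ n t, Measurable (w n t))
    (hw_indep : ∀ n, iIndepFun (fun t => w n t) μ)
    (hw_ident : ∀ n t, IdentDistrib (w n t) (w n 0) μ μ)
    (hw_L2 : ∀ n t i, MemLp (fun ω => w n t ω i) 2 μ)
    (hw_mean : ∀ n t i, ∫ ω, w n t ω i ∂μ = 0)
    (hw_cov : ∀ n t i j, cov[fun ω => w n t ω i, fun ω => w n t ω j; μ] = C n i j)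
    (hw_agents : iIndepFun (fun n ω t => w n t ω) μ)
    (hw_past : ∀ t, Indep (⨆ n, MeasurableSpace.comap (w n t) inferInstance)
      (SAFE.history G w t) μ)
    -- graphs: i.i.d. Laplacians, independent of the past and of the noise
    (hG_meas : ∀ t, Measurable fun ω => SAFE.laplacianEntries (G t ω))
    (hG_indep : iIndepFun (fun t ω => SAFE.laplacianEntries (G t ω)) μ)
    (hG_ident : ∀ t, IdentDistrib (fun ω => SAFE.laplacianEntries (G t ω))
      (fun ω => SAFE.laplacianEntries (G 0 ω)) μ μ)
    (hG_past : ∀ t, Indep (MeasurableSpace.comap (fun ω => SAFE.laplacianEntries (G t ω)) inferInstance)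
      (SAFE.history G w t) μ)
    (hGw : IndepFun (fun ω t => SAFE.laplacianEntries (G t ω)) (fun ω n t => w n t ω) μ)
    -- unit measurement vectors, coupling sets inside interest sets, every component interesting,
    -- global observability
    (hH_unit : ∀ p : SAFE.Stream P, ‖WithLp.toLp 2 (SAFE.measVec H p)‖ = 1)
    (hI_sub : ∀ n, SAFE.couplingSet (H n) ⊆ (I n : Set (Fin M)))
    (hI_cover : ∀ m, 0 < (SAFE.interestedAgents I m).card)
    (hobs : SAFE.GloballyObservable H Finset.univ)
    -- every induced subgraph is connected on average
    (hconn : ∀ m t, SAFE.ConnectedOnAverage μ (SAFE.interestedAgents I m) (G t))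
    -- not all streams are compromised, and the resilience condition holds
    (hA_card : ∀ᵐ ω ∂μ, (SAFE.compromised fun n t => a n t ω).card <
      Fintype.card (SAFE.Stream P))
    (hres : ∀ᵐ ω ∂μ, SAFE.Resilient H (SAFE.compromised fun n t => a n t ω))
    (n : Fin N) (τ₀ : ℝ) (hτ₀ : 0 ≤ τ₀) (hτ₀_lt : τ₀ < min S.τγ (1 / 2 - S.τγ)) :
    ∀ᵐ ω ∂μ, Tendsto
      (fun t : ℕ => ((t : ℝ) + 1) ^ τ₀ *
        ‖WithLp.toLp 2 (SAFE.estimate S H I (fun t => G t ω)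
            (SAFE.measurement H θ (fun n t => w n t ω) (fun n t => a n t ω)) t n
          - SAFE.restrictTo (I n) θ)‖)
      atTop (𝓝 0) := by
  -- The exceptional null set comes from the graphs and finitely many fixed vectors, so it does not
  -- depend on the attack.
  have hflow : ∀ᵐ ω ∂μ, ∀ m i, Tendsto (fun t : ℕ => ((t : ℝ) + 1) ^ 2 * ‖WithLp.toLp 2 (SAFE.flow
      (fun t => SAFE.edgeWeight (SAFE.interestedAgents I m) (G t ω)) (SAFE.decay S.b S.τ₂)
      (t - SAFE.window ((S.τ₁ + S.τ₂) / 2) t)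
      (SAFE.center (SAFE.interestedAgents I m) (Pi.single i 1))
      (SAFE.window ((S.τ₁ + S.τ₂) / 2) t))‖) atTop (𝓝 0) := by
    refine ae_all_iff.2 fun m => ae_all_iff.2 fun i => ?_
    obtain ⟨lam, hlam, hgap⟩ := SAFE.exists_spectralGap (hG_meas 0) _ (hconn m 0)
    have h12 := hS.τ₂_lt
    have h1 := hS.τ₁_lt
    refine SAFE.ae_tendsto_flow hG_meas hw_meas hG_past hlam (fun t z hz hs => ?_) hS.b_pos
      hS.τ₂_pos (by linarith) (by linarith) (fun j hj => by simp [SAFE.center, hj])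
      (SAFE.sum_center _ _)
    simp only [SAFE.integral_edgeWeight_eq (hG_ident t)]
    exact hgap z hz hs
  have hnoise : ∀ᵐ ω ∂μ, ∀ n i, Tendsto (fun t : ℕ => ((t : ℝ) + 1) ^ S.τγ
      * SAFE.timeAverage (fun t => w n t ω) t i) atTop (𝓝 0) := by
    refine ae_all_iff.2 fun n => ae_all_iff.2 fun i => ?_
    exact SAFE.ae_tendsto_noise_average hG_meas hw_meas hw_L2 hw_mean hw_ident hw_past
      (hS.τγ_lt.trans_le (min_le_left _ _)) n i
  filter_upwards [hflow, hnoise, hres] with ω hω₁ hω₂ hω₃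
  exact SAFE.tendsto_estimate_sub (G := fun t => G t ω) (w := fun n t => w n t ω)
    (a := fun n t => a n t ω) hS hH_unit hI_sub hI_cover θ hω₃ hω₂ hω₁ n
    (hτ₀_lt.trans_le (min_le_left _ _))
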